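/- Let $\zeta$ be the Riemann zeta function, and let $\rho$ run over its nontrivial zeros (the zeros other than $-2,-4,-6,\dots$), each repeated according to its multiplicity. For $k\ge 0$ put $$\mu_k=\frac{(-1)^k}{k!}\,\frac{d^k}{ds^k}\left[-\frac{\zeta'(s)}{\zeta(s)}\right]_{s=0},$$ and let $\eta_k$ be the coefficients of the Laurent expansion $$-\frac{\zeta'(s)}{\zeta(s)}=\frac{1}{s-1}+\sum_{k=0}^{\infty}\eta_k\,(s-1)^k$$ about $s=1$. Then, for every integer $k>0$, the series $\sum_\rho(-1/\rho)^{k+1}$ converges absolutely, and $$\sum_\rho\left(-\frac1\rho\right)^{k+1}=-\mu_k-2^{-(k+1)}\zeta(k+1)-(-1)^k$$ and $$\sum_\rho\left(-\frac1\rho\right)^{k+1}=\eta_k+(-1)^k\left(1-2^{-k-1}\right)\zeta(k+1)-(-1)^k .$$ -/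

import Mathlib

open Filter Topology

namespace ZetaPowerSums

/-- The set of nontrivial zeros of `ζ`: the zeros other than the trivial ones `-2, -4, -6, …`
(the point `1`, where `ζ` has its pole, is not a zero). -/
def nontrivialZeros : Set ℂ :=
  {ρ : ℂ | riemannZeta ρ = 0 ∧ (¬ ∃ n : ℕ, ρ = -2 * ((n : ℂ) + 1)) ∧ ρ ≠ 1}

/-- The multiplicity of `ρ` as a zero of `ζ`. -/
noncomputable def zeroMult (ρ : ℂ) : ℕ := analyticOrderNatAt riemannZeta ρ

/-- The function `-ζ'/ζ`. -/
noncomputable def negLogDerivZeta (s : ℂ) : ℂ := -(deriv riemannZeta s / riemannZeta s)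

/-- `μ_k = ((-1)^k / k!) (d/ds)^k [-ζ'(s)/ζ(s)]` at `s = 0`. -/
noncomputable def muCoeff (k : ℕ) : ℂ :=
  (-1) ^ k / (k.factorial : ℂ) * iteratedDeriv k negLogDerivZeta 0

/-- The regular part `-ζ'(s)/ζ(s) - 1/(s-1)` of `-ζ'/ζ` at its simple pole `s = 1`, the removable
singularity at `s = 1` being filled in with the limit. -/
noncomputable def regularPart : ℂ → ℂ :=
  Function.update (fun s => negLogDerivZeta s - 1 / (s - 1)) 1
    (limUnder (𝓝[≠] (1 : ℂ)) (fun s => negLogDerivZeta s - 1 / (s - 1)))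

/-- The Laurent coefficients `η_k` of `-ζ'/ζ` at `s = 1`, so that
`-ζ'(s)/ζ(s) = 1/(s-1) + ∑ k, η_k (s-1)^k` near `s = 1`; see `hasSum_etaCoeff`. -/
noncomputable def etaCoeff (k : ℕ) : ℂ :=
  iteratedDeriv k regularPart 1 / (k.factorial : ℂ)

theorem analyticAt_regularPart : AnalyticAt ℂ regularPart 1 := by
  set Z := DirichletCharacter.LFunctionTrivChar₁ 1 with hZ
  have hL : DirichletCharacter.LFunctionTrivChar 1 = riemannZeta :=
    DirichletCharacter.LFunction_modOne_eq
  have hd : Differentiable ℂ Z := DirichletCharacter.differentiable_LFunctionTrivChar₁ 1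
  have h1 : Z 1 ≠ 0 := DirichletCharacter.LFunctionTrivChar₁_apply_one_ne_zero 1
  have hG : AnalyticAt ℂ (fun s => -(deriv Z s / Z s)) 1 :=
    (((hd.analyticAt 1).deriv).div (hd.analyticAt 1) h1).neg
  have hev : (fun s => negLogDerivZeta s - 1 / (s - 1)) =ᶠ[𝓝[≠] (1 : ℂ)]
      fun s => -(deriv Z s / Z s) := by
    filter_upwards [self_mem_nhdsWithin,
      riemannZeta_eventually_ne_zero_nhds_one.filter_mono nhdsWithin_le_nhds] with s hs hz
    have hs1 : s ≠ 1 := hs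
    have hs0 : s - 1 ≠ 0 := sub_ne_zero.mpr hs1
    have e1 := DirichletCharacter.deriv_LFunctionTrivChar₁_apply_of_ne_one 1 hs1
    have e2 : Z s = (s - 1) * riemannZeta s := by
      rw [hZ, DirichletCharacter.LFunctionTrivChar₁, Function.update_of_ne hs1, hL]
    rw [e2, hZ, e1, hL, negLogDerivZeta]
    field_simp
    ring
  have hlim : limUnder (𝓝[≠] (1 : ℂ)) (fun s => negLogDerivZeta s - 1 / (s - 1)) =
      -(deriv Z 1 / Z 1) :=
    Tendsto.limUnder_eq
      ((hG.continuousAt.tendsto.mono_left nhdsWithin_le_nhds).congr' hev.symm)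
  refine hG.congr ?_
  rw [EventuallyEq, eventually_nhdsWithin_iff] at hev
  filter_upwards [hev] with s hs
  by_cases h : s = 1
  · subst h
    rw [regularPart, Function.update_self, hlim]
  · rw [regularPart, Function.update_of_ne h]
    exact (hs h).symm

theorem hasSum_etaCoeff : ∀ᶠ s in 𝓝[≠] (1 : ℂ),
    HasSum (fun k : ℕ => etaCoeff k * (s - 1) ^ k) (negLogDerivZeta s - 1 / (s - 1)) := by
  have h := analyticAt_regularPart.hasFPowerSeriesAt
  rw [hasFPowerSeriesAt_iff] at h
  have ht : Tendsto (fun s : ℂ => s - 1) (𝓝[≠] 1) (𝓝 0) :=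
    ((continuous_id.sub continuous_const).tendsto' (1 : ℂ) 0 (by simp)).mono_left
      nhdsWithin_le_nhds
  filter_upwards [ht.eventually h, self_mem_nhdsWithin] with s hs hs1
  have e : regularPart s = negLogDerivZeta s - 1 / (s - 1) := by
    rw [regularPart, Function.update_of_ne hs1]
  rw [add_sub_cancel, e] at hs
  simpa [etaCoeff, mul_comm, FormalMultilinearSeries.coeff_ofScalars] using hs

end ZetaPowerSums

/-! The entire function ξ(s) = s(s − 1)Λ(s) satisfies ξ(0) = 1, and its zeros are exactly the
nontrivial zeros of ζ, with the same multiplicities. A Hadamard product would give ∑ ρ^{-(k+1)} =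
−(ξ'/ξ)^{(k)}(0)/k!. Here this is proved without one, for any entire f with f(0) = 1 and |f(z)| ≤
exp(C(1 + |z|)^a), a < k + 1 (`hasSum_order_mul_inv_pow`). Divide f by the factors 1 − z/ρ of its
zeros in |z| ≤ R/2. The quotient is zero-free on |z| < R/2 and bounded there by max |f| on |z| = R,
so Borel–Carathéodory and Cauchy's estimate make the k-th Taylor coefficient of its logarithmic
derivative O(R^{a-(k+1)}), which tends to 0. Absolute convergence comes from counting zeros in
dyadic shells (`summable_order_mul_norm_inv_pow`). For ξ the exponent a = 3/2 is enough, since k ≥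
1.

Both formulas then come from the logarithmic derivative of ξ(s) = (s − 1) · 2π^{-s/2} Γ(s/2 + 1)
ζ(s) (`negLogDerivZeta_eq`). Comparing Taylor coefficients at s = 0 involves ψ^{(k)}(1), hence ζ(k +
1). At s = 1 the symmetry ξ(1 − s) = ξ(s) brings ξ'/ξ back to 0, and ψ^{(k)}(3/2) is a sum over the
odd integers from 3 on. The term (−1)^k comes from 1/(s − 1) in the first case and from the missing
odd integer 1 in the second. -/

namespace ZetaPowerSums

/-! ### Splitting zeros off an entire function -/

theorem analyticOrderAt_one_sub_div_pow_self {ρ : ℂ} (hρ : ρ ≠ 0) (n : ℕ) :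
    analyticOrderAt (fun z : ℂ => (1 - z / ρ) ^ n) ρ = n := by
  have h : AnalyticAt ℂ (fun z : ℂ => 1 - z / ρ) ρ := by fun_prop
  have h1 : analyticOrderAt (fun z : ℂ => 1 - z / ρ) ρ = 1 := by
    refine h.analyticOrderAt_eq_one_of_zero_deriv_ne_zero (by simp [hρ]) ?_
    have : HasDerivAt (fun z : ℂ => 1 - z / ρ) (-(1 / ρ)) ρ := by
      simpa using ((hasDerivAt_id ρ).div_const ρ).const_sub 1
    rw [this.deriv]
    simpa using hρ
  have := analyticOrderAt_pow h n
  rw [h1, nsmul_one] at this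
  exact this

/-- Zeros are removed one at a time by `dslope`, which stays entire because the singularity is
removable. Normalising the factor as 1 − z/ρ instead of z − ρ preserves the value at 0. -/
theorem exists_eq_one_sub_div_pow_mul {f : ℂ → ℂ} (hf : Differentiable ℂ f) {ρ : ℂ} (hρ : ρ ≠ 0)
    (n : ℕ) (hn : n ≤ analyticOrderAt f ρ) :
    ∃ g : ℂ → ℂ, Differentiable ℂ g ∧ ∀ z, f z = (1 - z / ρ) ^ n * g z := by
  induction n with
  | zero => exact ⟨f, hf, by simp⟩
  | succ n ih =>
    obtain ⟨g, hg, hfg⟩ := ih (le_trans (by exact_mod_cast n.le_succ) hn)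
    have hgρ : g ρ = 0 := by
      by_contra hne
      have h0 : analyticOrderAt g ρ = 0 := (hg.analyticAt ρ).analyticOrderAt_eq_zero.mpr hne
      have h1 : f = (fun z : ℂ => (1 - z / ρ) ^ n) * g := funext hfg
      rw [h1, analyticOrderAt_mul (by fun_prop) (hg.analyticAt ρ),
        analyticOrderAt_one_sub_div_pow_self hρ, h0, add_zero] at hn
      have : n + 1 ≤ n := by exact_mod_cast hn
      omega
    refine ⟨fun z => -ρ * dslope g ρ z, ?_, fun z => ?_⟩
    · have : Differentiable ℂ (dslope g ρ) := by
        rw [← differentiableOn_univ] at hg ⊢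
        exact (Complex.differentiableOn_dslope univ_mem).mpr hg
      fun_prop
    · have h := sub_smul_dslope g ρ z
      rw [hgρ, sub_zero, smul_eq_mul] at h
      have e : z - ρ = (1 - z / ρ) * -ρ := by field_simp; ring
      rw [hfg, ← h, e, pow_succ]
      generalize 1 - z / ρ = u
      ring

theorem exists_eq_prod_mul {f : ℂ → ℂ} (hf : Differentiable ℂ f)
    (htop : ∀ z, analyticOrderAt f z ≠ ⊤) (S : Finset ℂ) (hS : 0 ∉ S) :
    ∃ g : ℂ → ℂ, Differentiable ℂ g ∧
      (∀ z, f z = (∏ ρ ∈ S, (1 - z / ρ) ^ analyticOrderNatAt f ρ) * g z) ∧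
      ∀ ρ ∈ S, g ρ ≠ 0 := by
  classical
  induction S using Finset.induction_on with
  | empty => exact ⟨f, hf, by simp, by simp⟩
  | insert a S ha ih =>
    rw [Finset.mem_insert, not_or] at hS
    obtain ⟨g, hg, hfg, hgS⟩ := ih hS.2
    have ha0 : a ≠ 0 := fun h => hS.1 h.symm
    have hP : Differentiable ℂ fun z : ℂ => ∏ ρ ∈ S, (1 - z / ρ) ^ analyticOrderNatAt f ρ := by
      fun_prop
    -- The factors already removed do not vanish at `a`, so the quotient `g` keeps the order of `f`
    -- there.
    have hord : analyticOrderAt g a = analyticOrderNatAt f a := by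
      rw [Nat.cast_analyticOrderNatAt (htop a)]
      have h1 : f = (fun z : ℂ => ∏ ρ ∈ S, (1 - z / ρ) ^ analyticOrderNatAt f ρ) * g := funext hfg
      conv_rhs => rw [h1]
      rw [analyticOrderAt_mul (hP.analyticAt a) (hg.analyticAt a)]
      have : analyticOrderAt (fun z : ℂ => ∏ ρ ∈ S, (1 - z / ρ) ^ analyticOrderNatAt f ρ) a = 0 := by
        refine (hP.analyticAt a).analyticOrderAt_eq_zero.mpr ?_
        refine Finset.prod_ne_zero_iff.mpr fun ρ hρ => pow_ne_zero _ ?_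
        have hρ0 : ρ ≠ 0 := fun h => hS.2 (h ▸ hρ)
        rw [sub_ne_zero]
        intro h
        rw [eq_div_iff hρ0, one_mul] at h
        exact ha (h ▸ hρ)
      rw [this, zero_add]
    obtain ⟨h, hh, hgh⟩ := exists_eq_one_sub_div_pow_mul hg ha0 _ hord.ge
    refine ⟨h, hh, fun z => ?_, fun ρ hρ => ?_⟩
    · rw [hfg, hgh, Finset.prod_insert ha]
      ring
    · rcases Finset.mem_insert.mp hρ with rfl | hρ
      · rw [show g = (fun z : ℂ => (1 - z / ρ) ^ analyticOrderNatAt f ρ) * h from funext hgh,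
          analyticOrderAt_mul (by fun_prop) (hh.analyticAt ρ),
          analyticOrderAt_one_sub_div_pow_self ha0] at hord
        have h0 : analyticOrderAt h ρ = 0 := by
          have hne : analyticOrderAt h ρ ≠ ⊤ := by
            intro ht
            rw [ht] at hord
            simp at hord
          rw [← Nat.cast_analyticOrderNatAt hne] at hord ⊢
          have : analyticOrderNatAt f ρ + analyticOrderNatAt h ρ = analyticOrderNatAt f ρ := by
            exact_mod_cast hord
          have : analyticOrderNatAt h ρ = 0 := by omega
          simp [this]
        exact (hh.analyticAt ρ).analyticOrderAt_eq_zero.mp h0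
      · have := hgS ρ hρ
        rw [hgh] at this
        exact right_ne_zero_of_mul this

theorem analyticOrderAt_ne_top_of_apply_ne_zero {f : ℂ → ℂ} (hf : Differentiable ℂ f) {w : ℂ}
    (h0 : f w ≠ 0) (z : ℂ) : analyticOrderAt f z ≠ ⊤ := by
  have hA : AnalyticOnNhd ℂ f Set.univ := fun z _ => hf.analyticAt z
  refine hA.analyticOrderAt_ne_top_of_isPreconnected isPreconnected_univ (Set.mem_univ w)
    (Set.mem_univ z) ?_
  rw [(hf.analyticAt w).analyticOrderAt_eq_zero.mpr h0]
  simp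

theorem finite_zeros_inter_closedBall {f : ℂ → ℂ} (hf : Differentiable ℂ f) {w : ℂ}
    (h0 : f w ≠ 0) (r : ℝ) : {z | f z = 0 ∧ ‖z‖ ≤ r}.Finite := by
  have hA : AnalyticOnNhd ℂ f Set.univ := fun z _ => hf.analyticAt z
  have h := mem_codiscrete'.mp (hA.preimage_zero_mem_codiscrete h0)
  have e : (f ⁻¹' {0}ᶜ)ᶜ = {z | f z = 0} := by ext z; simp
  rw [e] at h
  have hc : IsClosed {z | f z = 0} := isClosed_eq hf.continuous continuous_const
  have h2 : IsCompact ({z | f z = 0} ∩ Metric.closedBall 0 r) :=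
    (isCompact_closedBall (0 : ℂ) r).inter_left hc
  refine (h2.finite (h.2.mono Set.inter_subset_left)).subset fun z hz => ⟨hz.1, ?_⟩
  simpa using hz.2

/-- The quotient of an entire function by the factors of some of its zeros is controlled on a disc
by the values of the function on the boundary circle. -/
theorem norm_quotient_le {f g : ℂ → ℂ} (hg : Differentiable ℂ g) {S : Finset ℂ} (hS : 0 ∉ S)
    {m : ℂ → ℕ} (hfg : ∀ z, f z = (∏ ρ ∈ S, (1 - z / ρ) ^ m ρ) * g z) {c R M : ℝ} (hc : 1 ≤ c)
    (hR : 0 < R) (hSR : ∀ ρ ∈ S, (c + 1) * ‖ρ‖ ≤ R) (hM : ∀ z, ‖z‖ = R → ‖f z‖ ≤ M) {z : ℂ}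
    (hz : ‖z‖ ≤ R) : c ^ (∑ ρ ∈ S, m ρ) * ‖g z‖ ≤ M := by
  -- On the circle |w/ρ| ≥ c + 1, so each factor has modulus at least c; the maximum principle
  -- carries the bound inside. The case c = 1 bounds the quotient, and c = 2 counts zeros.
  have hb : ∀ w, ‖w‖ = R → c ^ (∑ ρ ∈ S, m ρ) * ‖g w‖ ≤ M := by
    intro w hw
    refine le_trans ?_ (hM w hw)
    rw [hfg, norm_mul, norm_prod, ← Finset.prod_pow_eq_pow_sum]
    gcongr with ρ hρ
    rw [norm_pow]
    gcongr
    have hρ0 : ρ ≠ 0 := fun h => hS (h ▸ hρ)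
    have h1 : c + 1 ≤ ‖w / ρ‖ := by
      rw [norm_div, hw, le_div_iff₀ (norm_pos_iff.mpr hρ0)]
      exact hSR ρ hρ
    have h2 := norm_sub_norm_le (w / ρ) 1
    rw [norm_one, norm_sub_rev] at h2
    linarith
  have hcp : 0 < c ^ (∑ ρ ∈ S, m ρ) := by positivity
  rw [mul_comm, ← le_div_iff₀ hcp]
  refine Complex.norm_le_of_forall_mem_frontier_norm_le (U := Metric.ball 0 R)
    Metric.isBounded_ball hg.diffContOnCl (fun w hw => ?_) ?_
  · rw [frontier_ball _ hR.ne', mem_sphere_zero_iff_norm] at hw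
    rw [le_div_iff₀ hcp, mul_comm]
    exact hb w hw
  · rw [closure_ball _ hR.ne']
    simpa using hz

/-! ### Taylor coefficients of logarithmic derivatives -/

theorem iteratedDeriv_logDeriv_one_sub_div {ρ : ℂ} (hρ : ρ ≠ 0) (k : ℕ) :
    iteratedDeriv k (logDeriv fun z : ℂ => 1 - z / ρ) 0 = -(k.factorial * (1 / ρ) ^ (k + 1)) := by
  have e : (logDeriv fun z : ℂ => 1 - z / ρ) = fun z => -((-1) * z + ρ)⁻¹ := by
    funext z
    have : HasDerivAt (fun z : ℂ => 1 - z / ρ) (-(1 / ρ)) z := by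
      simpa using ((hasDerivAt_id z).div_const ρ).const_sub 1
    rw [logDeriv_apply, this.deriv]
    -- At z = ρ both sides are 0, the default value of division by zero.
    by_cases hz : z = ρ
    · simp [hz, hρ]
    · have : ρ - z ≠ 0 := sub_ne_zero.mpr (Ne.symm hz)
      rw [show -1 * z + ρ = ρ - z by ring, show 1 - z / ρ = (ρ - z) / ρ by field_simp]
      field_simp
  rw [e, iteratedDeriv_fun_neg, iteratedDeriv_eq_iterate, iter_deriv_inv_linear]
  have h1 : (ρ : ℂ) ^ (-1 - (k : ℤ)) = (1 / ρ) ^ (k + 1) := by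
    rw [show (-1 - (k : ℤ)) = -((k + 1 : ℕ) : ℤ) by push_cast; ring, zpow_neg, zpow_natCast]
    simp
  simp only [mul_zero, zero_add, h1]
  rw [mul_right_comm ((-1 : ℂ) ^ k), ← mul_pow]
  simp

theorem analyticAt_logDeriv {f : ℂ → ℂ} {z : ℂ} (hf : AnalyticAt ℂ f z) (hz : f z ≠ 0) :
    AnalyticAt ℂ (logDeriv f) z :=
  hf.deriv.div hf hz

/-- The coefficients of the logarithmic derivative of a function without zeros in a disc. -/
theorem norm_iteratedDeriv_logDeriv_le {g : ℂ → ℂ} (hg : Differentiable ℂ g) (hg0 : g 0 = 1)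
    {r B : ℝ} (hr : 0 < r) (hB : 0 < B) (hne : ∀ z, ‖z‖ < r → g z ≠ 0)
    (hle : ∀ z, ‖z‖ < r → ‖g z‖ ≤ Real.exp B) (k : ℕ) :
    ‖iteratedDeriv k (logDeriv g) 0‖ ≤ (k + 1).factorial * (2 * B) / (r / 2) ^ (k + 1) := by
  have hd : DifferentiableOn ℂ (logDeriv g) (Metric.ball 0 r) := fun z hz =>
    (analyticAt_logDeriv (hg.analyticAt z)
      (hne z (by simpa using hz))).differentiableAt.differentiableWithinAt
  -- A logarithm of `g`: the primitive of g'/g vanishing at 0. The bound on |g| becomes Re h ≤ B.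
  obtain ⟨h, h0, hh⟩ := hd.isExactOn_ball.with_val_at 0 0
  have hexp : ∀ z ∈ Metric.ball (0 : ℂ) r, g z = Complex.exp (h z) := by
    have hc : ∀ z ∈ Metric.ball (0 : ℂ) r,
        HasDerivAt (fun w => g w * Complex.exp (-h w)) 0 z := by
      intro z hz
      have h1 := (hg z).hasDerivAt.fun_mul ((hh z hz).fun_neg.cexp)
      have e : deriv g z * Complex.exp (-h z) + g z * (Complex.exp (-h z) * -logDeriv g z) = 0 := by
        rw [logDeriv_apply]
        have := hne z (by simpa using hz)
        field_simp
        ring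
      rwa [e] at h1
    intro z hz
    have h2 := Metric.isOpen_ball.is_const_of_deriv_eq_zero
      (convex_ball (0 : ℂ) r).isPreconnected
      (fun z hz => (hc z hz).differentiableAt.differentiableWithinAt)
      (fun z hz => (hc z hz).deriv) hz (Metric.mem_ball_self hr)
    simp only [hg0, h0, neg_zero, Complex.exp_zero, mul_one] at h2
    rw [Complex.exp_neg] at h2
    exact (mul_inv_eq_one₀ (Complex.exp_ne_zero _)).mp h2
  have hdh : DifferentiableOn ℂ h (Metric.ball 0 r) := fun z hz =>
    (hh z hz).differentiableAt.differentiableWithinAt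
  have hmap : Set.MapsTo h (Metric.ball 0 r) {z | z.re ≤ B} := by
    intro z hz
    have h3 := hle z (by simpa using hz)
    rw [hexp z hz, Complex.norm_exp, Real.exp_le_exp] at h3
    exact h3
  have hbound : ∀ z ∈ Metric.sphere (0 : ℂ) (r / 2), ‖h z‖ ≤ 2 * B := by
    intro z hz
    rw [mem_sphere_zero_iff_norm] at hz
    -- At |z| = r/2 the bound 2B|z|/(r − |z|) equals 2B.
    have := Complex.borelCaratheodory_zero hB hdh hmap hr
      (z := z) (by rw [mem_ball_zero_iff, hz]; linarith) h0
    rw [hz] at this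
    convert this using 1
    field_simp
    ring
  have hsub : Metric.closedBall (0 : ℂ) (r / 2) ⊆ Metric.ball 0 r :=
    Metric.closedBall_subset_ball (by linarith)
  have hcl : DiffContOnCl ℂ h (Metric.ball 0 (r / 2)) := by
    refine DifferentiableOn.diffContOnCl ?_
    rw [closure_ball _ (by positivity)]
    exact hdh.mono hsub
  -- Since h' = g'/g, Cauchy's estimate is needed for the derivative of order k + 1 of `h`.
  have := Complex.norm_iteratedDeriv_le_of_forall_mem_sphere_norm_le (k + 1) (by positivity) hcl
    hbound
  rw [iteratedDeriv_succ'] at this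
  have hev : deriv h =ᶠ[𝓝 0] logDeriv g := by
    filter_upwards [Metric.ball_mem_nhds (0 : ℂ) hr] with z hz using (hh z hz).deriv
  rwa [hev.iteratedDeriv_eq] at this

/-- The logarithmic derivative at `0` of an entire function, up to the contribution of the zeros in
a disc. -/
theorem norm_sum_zeros_add_iteratedDeriv_le {f : ℂ → ℂ} (hf : Differentiable ℂ f) (hf0 : f 0 = 1)
    {R B : ℝ} (hR : 0 < R) (hB : 0 < B) (hle : ∀ z, ‖z‖ = R → ‖f z‖ ≤ Real.exp B)
    {S : Finset ℂ} (hS : ∀ z, z ∈ S ↔ f z = 0 ∧ ‖z‖ ≤ R / 2) (k : ℕ) :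
    ‖∑ ρ ∈ S, (analyticOrderNatAt f ρ : ℂ) * (1 / ρ) ^ (k + 1)
      + iteratedDeriv k (logDeriv f) 0 / k.factorial‖ ≤ (k + 1) * (2 * B) / (R / 4) ^ (k + 1) := by
  have hS0 : 0 ∉ S := fun h => by simpa [hf0] using ((hS 0).mp h).1
  obtain ⟨g, hg, hfg, hgS⟩ := exists_eq_prod_mul hf
    (analyticOrderAt_ne_top_of_apply_ne_zero hf (w := 0) (by simp [hf0])) S hS0
  have hg0 : g 0 = 1 := by simpa [hf0] using (hfg 0).symm
  have hgne : ∀ z, ‖z‖ < R / 2 → g z ≠ 0 := by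
    intro z hz h
    exact hgS z ((hS z).mpr ⟨by rw [hfg, h, mul_zero], hz.le⟩) h
  have hgle : ∀ z, ‖z‖ < R / 2 → ‖g z‖ ≤ Real.exp B := by
    intro z hz
    have := norm_quotient_le hg hS0 hfg le_rfl hR
      (fun ρ hρ => by linarith [((hS ρ).mp hρ).2]) hle (z := z) (by linarith)
    simpa using this
  have hmain := norm_iteratedDeriv_logDeriv_le hg hg0 (by positivity : 0 < R / 2) hB hgne hgle k
  have hne0 : ∀ ρ ∈ S, ρ ≠ 0 := fun ρ hρ h => hS0 (h ▸ hρ)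
  have hev : logDeriv f =ᶠ[𝓝 0] fun z =>
      (∑ ρ ∈ S, (analyticOrderNatAt f ρ : ℂ) * logDeriv (fun z : ℂ => 1 - z / ρ) z)
        + logDeriv g z := by
    have h1 : ∀ᶠ z in 𝓝 (0 : ℂ), f z ≠ 0 :=
      hf.continuous.continuousAt.eventually_ne (by simp [hf0])
    filter_upwards [h1] with z hz
    rw [hfg] at hz
    have hP := left_ne_zero_of_mul hz
    rw [show f = fun z => (∏ ρ ∈ S, (1 - z / ρ) ^ analyticOrderNatAt f ρ) * g z from funext hfg,
      logDeriv_mul z hP (right_ne_zero_of_mul hz) (by fun_prop) (hg z),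
      logDeriv_prod (Finset.prod_ne_zero_iff.mp hP) (fun ρ _ => by fun_prop)]
    congr 1
    refine Finset.sum_congr rfl fun ρ hρ => ?_
    rw [← show f = fun z => (∏ ρ ∈ S, (1 - z / ρ) ^ analyticOrderNatAt f ρ) * g z from funext hfg,
      logDeriv_fun_pow (by fun_prop)]
  have hA : ∀ ρ ∈ S, AnalyticAt ℂ (logDeriv fun z : ℂ => 1 - z / ρ) 0 := fun ρ _ =>
    analyticAt_logDeriv (by fun_prop) (by simp)
  have hAg : AnalyticAt ℂ (logDeriv g) 0 := analyticAt_logDeriv (hg.analyticAt 0) (by simp [hg0])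
  have hk : (k.factorial : ℂ) ≠ 0 := by exact_mod_cast k.factorial_ne_zero
  have hAm : ∀ ρ ∈ S, AnalyticAt ℂ
      (fun z => (analyticOrderNatAt f ρ : ℂ) * logDeriv (fun z : ℂ => 1 - z / ρ) z) 0 :=
    fun ρ hρ => analyticAt_const.mul (hA ρ hρ)
  have hiter : iteratedDeriv k (logDeriv f) 0 =
      -(k.factorial * ∑ ρ ∈ S, (analyticOrderNatAt f ρ : ℂ) * (1 / ρ) ^ (k + 1))
        + iteratedDeriv k (logDeriv g) 0 := by
    rw [hev.iteratedDeriv_eq, iteratedDeriv_fun_add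
      ((Finset.analyticAt_fun_sum S hAm).contDiffAt) hAg.contDiffAt,
      iteratedDeriv_fun_sum (fun ρ hρ => (hAm ρ hρ).contDiffAt), Finset.mul_sum,
      ← Finset.sum_neg_distrib]
    congr 1
    refine Finset.sum_congr rfl fun ρ hρ => ?_
    rw [iteratedDeriv_const_mul_field, iteratedDeriv_logDeriv_one_sub_div (hne0 ρ hρ)]
    ring
  have e : ∑ ρ ∈ S, (analyticOrderNatAt f ρ : ℂ) * (1 / ρ) ^ (k + 1)
      + iteratedDeriv k (logDeriv f) 0 / k.factorial
      = iteratedDeriv k (logDeriv g) 0 / k.factorial := by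
    rw [hiter]
    field_simp
    ring
  rw [e, norm_div, Complex.norm_natCast, div_le_iff₀ (by positivity)]
  refine hmain.trans (le_of_eq ?_)
  rw [Nat.factorial_succ, show R / 2 / 2 = R / 4 by ring]
  push_cast
  ring

/-! ### Counting zeros and summing their inverse powers -/

/-- A bound for the number of zeros in a disc. -/
theorem sum_order_le {f : ℂ → ℂ} (hf : Differentiable ℂ f) (hf0 : f 0 = 1) {r B : ℝ} (hr : 0 < r)
    (hle : ∀ z, ‖z‖ = 3 * r → ‖f z‖ ≤ Real.exp B) (S : Finset ℂ)
    (hS : ∀ ρ ∈ S, ρ ≠ 0 ∧ ‖ρ‖ ≤ r) :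
    ((∑ ρ ∈ S, analyticOrderNatAt f ρ : ℕ) : ℝ) ≤ B / Real.log 2 := by
  have hS0 : 0 ∉ S := fun h => (hS 0 h).1 rfl
  obtain ⟨g, hg, hfg, -⟩ := exists_eq_prod_mul hf
    (analyticOrderAt_ne_top_of_apply_ne_zero hf (w := 0) (by simp [hf0])) S hS0
  have hg0 : g 0 = 1 := by simpa [hf0] using (hfg 0).symm
  -- Evaluated at z = 0, where g = 1, this reads 2^N ≤ e^B for N zeros counted with multiplicity.
  have := norm_quotient_le hg hS0 hfg (c := 2) (by norm_num) (by positivity : 0 < 3 * r)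
    (fun ρ hρ => by linarith [(hS ρ hρ).2]) hle (z := 0) (by simp; positivity)
  rw [hg0, norm_one, mul_one] at this
  have h2 := Real.log_le_log (by positivity) this
  rw [Real.log_exp, Real.log_pow] at h2
  rwa [le_div_iff₀ (Real.log_pos (by norm_num))]

/-- The shell δ2^j ≤ |ρ| < δ2^(j+1) contains O(2^(aj)) zeros, each contributing O(2^(-mj)), so the
shells are dominated by a geometric series of ratio 2^(a-m) < 1. The radius δ exists because f(0) ≠
0. -/
theorem summable_order_mul_norm_inv_pow {f : ℂ → ℂ} (hf : Differentiable ℂ f) (hf0 : f 0 = 1)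
    {a C : ℝ} (ha : 0 ≤ a) (hgrowth : ∀ z, ‖f z‖ ≤ Real.exp (C * (1 + ‖z‖) ^ a)) {m : ℕ}
    (hm : a < m) : Summable fun ρ : ℂ => (analyticOrderNatAt f ρ : ℝ) * (1 / ‖ρ‖) ^ m := by
  classical
  have hC : 0 ≤ C := by
    have := hgrowth 0
    rw [hf0, norm_one, norm_zero, add_zero, Real.one_rpow, mul_one] at this
    exact Real.one_le_exp_iff.mp this
  obtain ⟨δ, hδ, hδf⟩ : ∃ δ > 0, ∀ z, ‖z‖ < δ → f z ≠ 0 := by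
    have h1 : ∀ᶠ z in 𝓝 (0 : ℂ), f z ≠ 0 :=
      hf.continuous.continuousAt.eventually_ne (by simp [hf0])
    obtain ⟨δ, hδ, h⟩ := Metric.eventually_nhds_iff.mp h1
    exact ⟨δ, hδ, fun z hz => h (by simpa using hz)⟩
  have hl2 : 0 < Real.log 2 := Real.log_pos (by norm_num)
  set q : ℝ := 2 ^ a / 2 ^ m with hq
  have hq0 : 0 ≤ q := by positivity
  have hq1 : q < 1 := by
    rw [hq, div_lt_one (by positivity), ← Real.rpow_natCast]
    exact Real.rpow_lt_rpow_of_exponent_lt (by norm_num) hm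
  set K : ℝ := C * (1 + 6 * δ) ^ a / Real.log 2 * (1 / δ) ^ m with hK
  have hK0 : 0 ≤ K := by positivity
  have hshell : ∀ (u : Finset ℂ) (j : ℕ), (∀ ρ ∈ u, δ * 2 ^ j ≤ ‖ρ‖ ∧ ‖ρ‖ < δ * 2 ^ (j + 1)) →
      ∑ ρ ∈ u, (analyticOrderNatAt f ρ : ℝ) * (1 / ‖ρ‖) ^ m ≤ K * q ^ j := by
    intro u j hu
    have hpos : ∀ ρ ∈ u, 0 < ‖ρ‖ := fun ρ hρ => lt_of_lt_of_le (by positivity) (hu ρ hρ).1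
    have hcount := sum_order_le hf hf0 (r := δ * 2 ^ (j + 1))
      (B := C * (1 + 3 * (δ * 2 ^ (j + 1))) ^ a) (by positivity)
      (fun z hz => by simpa [hz] using hgrowth z) u
      (fun ρ hρ => ⟨norm_pos_iff.mp (hpos ρ hρ), (hu ρ hρ).2.le⟩)
    have hB : (1 + 3 * (δ * 2 ^ (j + 1))) ^ a ≤ (1 + 6 * δ) ^ a * (2 ^ a) ^ j := by
      rw [← Real.rpow_natCast (2 ^ a), ← Real.rpow_mul (by norm_num), mul_comm a,
        Real.rpow_mul (by norm_num), Real.rpow_natCast, ← Real.mul_rpow (by positivity)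
        (by positivity)]
      refine Real.rpow_le_rpow (by positivity) ?_ ha
      have : (1 : ℝ) ≤ 2 ^ j := one_le_pow₀ (by norm_num)
      rw [pow_succ]
      nlinarith
    calc ∑ ρ ∈ u, (analyticOrderNatAt f ρ : ℝ) * (1 / ‖ρ‖) ^ m
        ≤ ∑ ρ ∈ u, (analyticOrderNatAt f ρ : ℝ) * (1 / (δ * 2 ^ j)) ^ m := by
          gcongr with ρ hρ
          exact (hu ρ hρ).1
      _ = ((∑ ρ ∈ u, analyticOrderNatAt f ρ : ℕ) : ℝ) * (1 / (δ * 2 ^ j)) ^ m := by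
          rw [Nat.cast_sum, Finset.sum_mul]
      _ ≤ (C * ((1 + 6 * δ) ^ a * (2 ^ a) ^ j) / Real.log 2) * (1 / (δ * 2 ^ j)) ^ m := by
          gcongr
          refine hcount.trans ?_
          gcongr
      _ = K * q ^ j := by
          simp only [hK, hq, div_pow, mul_pow, one_pow]
          rw [pow_right_comm (2 : ℝ) j m]
          field_simp
  refine summable_of_sum_le (c := K * (1 - q)⁻¹) (fun ρ => by positivity) fun u => ?_
  have hex : ∀ ρ : ℂ, ∃ j : ℕ, f ρ = 0 → δ * 2 ^ j ≤ ‖ρ‖ ∧ ‖ρ‖ < δ * 2 ^ (j + 1) := by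
    intro ρ
    by_cases h : f ρ = 0
    · have h1 : 1 ≤ ‖ρ‖ / δ := by
        rw [le_div_iff₀ hδ, one_mul]
        by_contra hlt
        exact hδf ρ (not_le.mp hlt) h
      obtain ⟨j, hj1, hj2⟩ := exists_nat_pow_near h1 (one_lt_two (α := ℝ))
      rw [le_div_iff₀ hδ, mul_comm] at hj1
      rw [div_lt_iff₀ hδ, mul_comm] at hj2
      exact ⟨j, fun _ => ⟨hj1, hj2⟩⟩
    · exact ⟨0, fun h' => absurd h' h⟩
  choose j hj using hex
  have hsub : ∑ ρ ∈ u, (analyticOrderNatAt f ρ : ℝ) * (1 / ‖ρ‖) ^ m =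
      ∑ ρ ∈ u.filter (fun ρ => f ρ = 0), (analyticOrderNatAt f ρ : ℝ) * (1 / ‖ρ‖) ^ m := by
    rw [Finset.sum_filter_of_ne]
    intro ρ _ hne
    refine apply_eq_zero_of_analyticOrderNatAt_ne_zero fun h => hne ?_
    rw [h, Nat.cast_zero, zero_mul]
  set v := u.filter (fun ρ => f ρ = 0) with hv
  rw [hsub, ← Finset.sum_fiberwise_of_maps_to (t := v.image j)
    (fun ρ hρ => Finset.mem_image_of_mem j hρ)]
  calc _ ≤ ∑ i ∈ v.image j, K * q ^ i := by
        refine Finset.sum_le_sum fun i _ => hshell _ i fun ρ hρ => ?_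
        rw [Finset.mem_filter] at hρ
        have := hj ρ (Finset.mem_filter.mp hρ.1).2
        rwa [hρ.2] at this
    _ = K * ∑ i ∈ v.image j, q ^ i := by rw [Finset.mul_sum]
    _ ≤ K * (1 - q)⁻¹ := by
        gcongr
        rw [← tsum_geometric_of_lt_one hq0 hq1]
        exact (summable_geometric_of_lt_one hq0 hq1).sum_le_tsum _ fun i _ => by positivity

/-- Power sums of the reciprocals of the zeros of an entire function of finite order. -/
theorem hasSum_order_mul_inv_pow {f : ℂ → ℂ} (hf : Differentiable ℂ f) (hf0 : f 0 = 1)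
    {a C : ℝ} (ha : 0 ≤ a) (hgrowth : ∀ z, ‖f z‖ ≤ Real.exp (C * (1 + ‖z‖) ^ a)) {k : ℕ}
    (hk : a < k + 1) :
    HasSum (fun ρ : ℂ => (analyticOrderNatAt f ρ : ℂ) * (1 / ρ) ^ (k + 1))
      (-(iteratedDeriv k (logDeriv f) 0 / k.factorial)) := by
  classical
  set t : ℂ → ℂ := fun ρ => (analyticOrderNatAt f ρ : ℂ) * (1 / ρ) ^ (k + 1) with ht
  set L : ℂ := iteratedDeriv k (logDeriv f) 0 / k.factorial with hL
  have hsn : Summable fun ρ => ‖t ρ‖ := by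
    have := summable_order_mul_norm_inv_pow hf hf0 ha hgrowth (m := k + 1) (by exact_mod_cast hk)
    simpa [ht] using this
  have hfin : ∀ n : ℕ, {z | f z = 0 ∧ ‖z‖ ≤ (n : ℝ) / 2}.Finite := fun n =>
    finite_zeros_inter_closedBall hf (w := 0) (by simp [hf0]) _
  set S : ℕ → Finset ℂ := fun n => (hfin n).toFinset with hS
  have hmem : ∀ n z, z ∈ S n ↔ f z = 0 ∧ ‖z‖ ≤ (n : ℝ) / 2 := fun n z => by simp [hS]
  -- The sums over the zeros with |ρ| ≤ n/2 have two limits: the full sum, by dominated convergence,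
  -- and −L, by the disc estimate with R = n.
  have hlim1 : Tendsto (fun n => ∑ ρ ∈ S n, t ρ) atTop (𝓝 (∑' ρ, t ρ)) := by
    have h := tendsto_tsum_of_dominated_convergence (𝓕 := atTop) hsn
      (f := fun (n : ℕ) ρ => if ρ ∈ S n then t ρ else 0) (g := t) ?_ ?_
    · refine h.congr fun n => ?_
      rw [tsum_eq_sum (s := S n) fun ρ hρ => if_neg hρ]
      exact Finset.sum_congr rfl fun ρ hρ => if_pos hρ
    · intro ρ
      by_cases hρ : f ρ = 0
      · refine tendsto_const_nhds.congr' ?_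
        filter_upwards [eventually_ge_atTop ⌈2 * ‖ρ‖⌉₊] with n hn
        rw [if_pos]
        rw [hmem]
        refine ⟨hρ, ?_⟩
        have := Nat.ceil_le.mp hn
        linarith
      · have : t ρ = 0 := by
          have h0 : analyticOrderNatAt f ρ = 0 := by
            by_contra h
            exact hρ (apply_eq_zero_of_analyticOrderNatAt_ne_zero h)
          simp [ht, h0]
        simp [this]
    · refine Eventually.of_forall fun n ρ => ?_
      split_ifs
      · exact le_rfl
      · simp
  have hlim2 : Tendsto (fun n => ∑ ρ ∈ S n, t ρ) atTop (𝓝 (-L)) := by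
    have hC : 0 ≤ C := by
      have := hgrowth 0
      rw [hf0, norm_one, norm_zero, add_zero, Real.one_rpow, mul_one] at this
      exact Real.one_le_exp_iff.mp this
    have hz : Tendsto (fun n : ℕ => ((k : ℝ) + 1) * (2 * (C + 1)) * 2 ^ a * 4 ^ (k + 1) *
        (n : ℝ) ^ (-((k : ℝ) + 1 - a))) atTop (𝓝 0) := by
      rw [← mul_zero (((k : ℝ) + 1) * (2 * (C + 1)) * 2 ^ a * 4 ^ (k + 1))]
      exact ((tendsto_rpow_neg_atTop (by linarith : 0 < (k : ℝ) + 1 - a)).comp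
        tendsto_natCast_atTop_atTop).const_mul _
    rw [tendsto_iff_norm_sub_tendsto_zero]
    refine squeeze_zero' (Eventually.of_forall fun _ => norm_nonneg _) ?_ hz
    filter_upwards [eventually_ge_atTop 1] with n hn
    have hn1 : (1 : ℝ) ≤ n := by exact_mod_cast hn
    have hn0 : (0 : ℝ) < n := by linarith
    -- C + 1 replaces C because the estimate needs B > 0.
    have hb := norm_sum_zeros_add_iteratedDeriv_le hf hf0 (R := n)
      (B := (C + 1) * (1 + n) ^ a) hn0 (by positivity) (fun z hz => by
        refine (hgrowth z).trans ?_
        rw [hz]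
        gcongr
        linarith) (hmem n) k
    rw [sub_neg_eq_add]
    refine hb.trans ?_
    have h2 : (1 + (n : ℝ)) ^ a ≤ 2 ^ a * (n : ℝ) ^ a := by
      rw [← Real.mul_rpow (by norm_num) hn0.le]
      exact Real.rpow_le_rpow (by positivity) (by linarith) ha
    have h3 : (n : ℝ) ^ (-((k : ℝ) + 1 - a)) = n ^ a / n ^ (k + 1) := by
      rw [show -((k : ℝ) + 1 - a) = a - ((k + 1 : ℕ) : ℝ) by push_cast; ring,
        Real.rpow_sub hn0, Real.rpow_natCast]
    rw [h3, div_pow, div_div_eq_mul_div, mul_div_assoc']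
    gcongr ?_ / _
    calc ((k : ℝ) + 1) * (2 * ((C + 1) * (1 + n) ^ a)) * 4 ^ (k + 1)
        ≤ ((k : ℝ) + 1) * (2 * ((C + 1) * (2 ^ a * n ^ a))) * 4 ^ (k + 1) := by gcongr
      _ = _ := by ring
  rw [← tendsto_nhds_unique hlim1 hlim2]
  exact (Summable.of_norm hsn).hasSum

/-! ### Growth of the completed zeta function -/

/-- A crude form of Stirling. Shifting by 2 moves the argument to where Γ is increasing and
comparable with factorials; then log x ≤ 2√x yields the exponent 3/2. The constant 16 absorbs 1/(u(u
+ 1)) for u ≥ 1/4. -/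
theorem Gamma_le_exp_rpow {u : ℝ} (hu : 1 / 4 ≤ u) :
    Real.Gamma u ≤ 16 * Real.exp (2 * (u + 2) ^ (3 / 2 : ℝ)) := by
  have hu0 : 0 < u := by linarith
  have h1 : Real.Gamma (u + 2) = (u + 1) * (u * Real.Gamma u) := by
    rw [show u + 2 = (u + 1) + 1 by ring, Real.Gamma_add_one (by linarith),
      Real.Gamma_add_one hu0.ne']
  have hG := Real.Gamma_pos_of_pos hu0
  have h2 : Real.Gamma u ≤ 16 * Real.Gamma (u + 2) := by
    rw [h1]
    have : 1 ≤ 16 * ((u + 1) * u) := by nlinarith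
    nlinarith
  have h3 : Real.Gamma (u + 2) ≤ (u + 2) ^ (u + 2) := by
    set n := ⌈u⌉₊ with hn
    have hn1 : u ≤ n := Nat.le_ceil u
    have hn2 : (n : ℝ) + 1 ≤ u + 2 := by linarith [Nat.ceil_lt_add_one hu0.le]
    calc Real.Gamma (u + 2) ≤ Real.Gamma (((n + 1 : ℕ) : ℝ) + 1) := by
          refine Real.Gamma_strictMonoOn_Ici.monotoneOn ?_ ?_ ?_
          · simp; linarith
          · simp; linarith
          · push_cast; linarith
      _ = ((n + 1).factorial : ℝ) := Real.Gamma_nat_eq_factorial (n + 1)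
      _ ≤ ((n + 1 : ℕ) : ℝ) ^ (n + 1) := by exact_mod_cast Nat.factorial_le_pow (n + 1)
      _ = ((n : ℝ) + 1) ^ ((n : ℝ) + 1) := by
          rw [← Real.rpow_natCast]
          push_cast
          rfl
      _ ≤ (u + 2) ^ ((n : ℝ) + 1) := Real.rpow_le_rpow (by positivity) hn2 (by positivity)
      _ ≤ (u + 2) ^ (u + 2) := Real.rpow_le_rpow_of_exponent_le (by linarith) hn2
  have h4 : (u + 2) ^ (u + 2) ≤ Real.exp (2 * (u + 2) ^ (3 / 2 : ℝ)) := by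
    have hx : 0 < u + 2 := by linarith
    rw [Real.rpow_def_of_pos hx, Real.exp_le_exp]
    have := Real.log_le_rpow_div hx.le (ε := 1 / 2) (by norm_num)
    calc Real.log (u + 2) * (u + 2) ≤ ((u + 2) ^ (1 / 2 : ℝ) / (1 / 2)) * (u + 2) := by gcongr
      _ = 2 * (u + 2) ^ (3 / 2 : ℝ) := by
        rw [show (3 / 2 : ℝ) = 1 / 2 + 1 by norm_num, Real.rpow_add_one hx.ne']
        ring
  linarith [h2, h3.trans h4]

/-- Λ₀ is the Mellin transform of the modified theta kernel. On t ≤ T the integrand is compared with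
the one at the fixed point 1/4; on t > T the kernel minus its limit decays exponentially, which
leaves a Gamma integral. The bound 1/4 corresponds to Re s ≥ 1/2, since w = s/2. -/
theorem exists_norm_mellin_modif_le : ∃ T ≥ (1 : ℝ), ∃ I ≥ (0 : ℝ), ∃ A ≥ (0 : ℝ), ∃ p > (0 : ℝ),
    ∀ w : ℂ, 1 / 4 ≤ w.re → ‖(HurwitzZeta.hurwitzEvenFEPair 0).Λ₀ w‖ ≤
      T ^ w.re * I + A * ((1 / p) ^ w.re * Real.Gamma w.re) := by
  set P := HurwitzZeta.hurwitzEvenFEPair 0 with hP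
  obtain ⟨p, hp, hO⟩ := HurwitzZeta.isBigO_atTop_evenKernel_sub 0
  obtain ⟨A, hA, hO⟩ := hO.exists_nonneg
  obtain ⟨T₀, hT₀⟩ := eventually_atTop.mp hO.bound
  set T := max T₀ 1 with hT
  have hT1 : 1 ≤ T := le_max_right _ _
  have hdecay : ∀ t, T < t → ‖P.f_modif t‖ ≤ A * Real.exp (-(p * t)) := by
    intro t ht
    have h1 := hT₀ t ((le_max_left _ _).trans ht.le)
    have h1t : 1 < t := hT1.trans_lt ht
    have h2 : P.f_modif t = ((HurwitzZeta.evenKernel 0 t - 1 : ℝ) : ℂ) := by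
      rw [WeakFEPair.f_modif, Pi.add_apply, Set.indicator_of_mem (Set.mem_Ioi.mpr h1t),
        Set.indicator_of_notMem (fun h => absurd h.2 (not_lt.mpr h1t.le))]
      simp [hP, HurwitzZeta.hurwitzEvenFEPair]
    rw [h2, Complex.norm_real]
    rw [if_pos rfl, Real.norm_of_nonneg (Real.exp_pos _).le, neg_mul] at h1
    exact h1
  have hconv : ∀ w : ℂ, MeasureTheory.IntegrableOn
      (fun t : ℝ => t ^ (w.re - 1) * ‖P.f_modif t‖) (Set.Ioi 0) := by
    intro w
    have h := (P.isStrongFEPair_toStrongFEPair.hasMellin w).1.norm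
    refine MeasureTheory.IntegrableOn.congr_fun h (fun t ht => ?_) measurableSet_Ioi
    rw [norm_smul, Complex.norm_cpow_eq_rpow_re_of_pos ht]
    simp [WeakFEPair.toStrongFEPair]
  refine ⟨T, hT1, ∫ t in Set.Ioi (0 : ℝ), t ^ ((1 / 4 : ℂ).re - 1) * ‖P.f_modif t‖, ?_,
    A, hA, p, hp, fun w hw => ?_⟩
  · refine MeasureTheory.setIntegral_nonneg measurableSet_Ioi fun t ht => ?_
    have : (0 : ℝ) < t := ht
    positivity
  have hw0 : 0 < w.re := by linarith
  have hG := Real.integral_rpow_mul_exp_neg_mul_Ioi hw0 hp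
  have hGi : MeasureTheory.IntegrableOn
      (fun t : ℝ => t ^ (w.re - 1) * Real.exp (-(p * t))) (Set.Ioi 0) := by
    -- A non-integrable function has integral 0 by convention, so a nonzero value proves
    -- integrability.
    refine MeasureTheory.Integrable.of_integral_ne_zero ?_
    rw [hG]
    have := Real.Gamma_pos_of_pos hw0
    positivity
  rw [← hG, ← MeasureTheory.integral_const_mul, ← MeasureTheory.integral_const_mul,
    ← MeasureTheory.integral_add ((hconv (1 / 4)).const_mul _) (hGi.const_mul _)]
  refine (MeasureTheory.norm_integral_le_integral_norm _).trans ?_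
  refine MeasureTheory.setIntegral_mono_on ?_
    (((hconv (1 / 4)).const_mul _).add (hGi.const_mul _)) measurableSet_Ioi fun t ht => ?_
  · exact (P.isStrongFEPair_toStrongFEPair.hasMellin w).1.norm
  have ht0 : (0 : ℝ) < t := ht
  rw [norm_smul, Complex.norm_cpow_eq_rpow_re_of_pos ht0, Complex.sub_re, Complex.one_re]
  have hre : (1 / 4 : ℂ).re = 1 / 4 := by norm_num
  rw [hre]
  rcases le_or_gt t T with h | h
  · have h1 : t ^ (w.re - 1) ≤ T ^ w.re * t ^ ((1 / 4 : ℝ) - 1) := by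
      rw [show w.re - 1 = (w.re - 1 / 4) + (1 / 4 - 1) by ring, Real.rpow_add ht0]
      gcongr
      calc t ^ (w.re - 1 / 4) ≤ T ^ (w.re - 1 / 4) :=
            Real.rpow_le_rpow ht0.le h (by linarith)
        _ ≤ T ^ w.re := Real.rpow_le_rpow_of_exponent_le hT1 (by linarith)
    have h2 : 0 ≤ A * (t ^ (w.re - 1) * Real.exp (-(p * t))) := by positivity
    have h3 := mul_le_mul_of_nonneg_right h1 (norm_nonneg (P.f_modif t))
    linarith
  · have h1 := mul_le_mul_of_nonneg_left (hdecay t h) (Real.rpow_nonneg ht0.le (w.re - 1))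
    have h2 : 0 ≤ T ^ w.re * (t ^ ((1 / 4 : ℝ) - 1) * ‖P.f_modif t‖) := by positivity
    linarith

/-- The function `Λ₀` has order at most `3 / 2`. -/
theorem exists_norm_completedRiemannZeta₀_le : ∃ C ≥ (0 : ℝ), ∀ s : ℂ,
    ‖completedRiemannZeta₀ s‖ ≤ Real.exp (C * (1 + ‖s‖) ^ (3 / 2 : ℝ)) := by
  obtain ⟨T, hT, I, hI, A, hA, p, hp, hbound⟩ := exists_norm_mellin_modif_le
  set Q := max (1 / p) 1 with hQ
  have hQ1 : 1 ≤ Q := le_max_right _ _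
  have hlT : 0 ≤ Real.log T := Real.log_nonneg hT
  have hlQ : 0 ≤ Real.log Q := Real.log_nonneg hQ1
  have hright : ∀ s : ℂ, 1 / 2 ≤ s.re → ‖completedRiemannZeta₀ s‖ ≤
      T ^ ‖s‖ * I + 16 * A * (Q ^ ‖s‖ * Real.exp (2 * (‖s‖ + 2) ^ (3 / 2 : ℝ))) := by
    intro s hs
    have hre : (s / 2).re = s.re / 2 := by simp
    have h := hbound (s / 2) (by rw [hre]; linarith)
    have h1 : ‖completedRiemannZeta₀ s‖ ≤ ‖(HurwitzZeta.hurwitzEvenFEPair 0).Λ₀ (s / 2)‖ := by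
      rw [completedRiemannZeta₀, HurwitzZeta.completedHurwitzZetaEven₀, norm_div]
      exact div_le_self (norm_nonneg _) (by norm_num)
    refine (h1.trans h).trans ?_
    have hs1 : (s / 2).re ≤ ‖s‖ := by
      rw [hre]
      linarith [Complex.re_le_norm s]
    have hs2 : 1 / 4 ≤ (s / 2).re := by rw [hre]; linarith
    generalize (s / 2).re = u at hs1 hs2
    have hG := Gamma_le_exp_rpow hs2
    have hG0 := Real.Gamma_pos_of_pos (show 0 < u by linarith)
    calc T ^ u * I + A * ((1 / p) ^ u * Real.Gamma u)
        ≤ T ^ ‖s‖ * I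
          + A * (Q ^ ‖s‖ * (16 * Real.exp (2 * (‖s‖ + 2) ^ (3 / 2 : ℝ)))) := by
          gcongr
          · calc (1 / p) ^ u ≤ Q ^ u :=
                  Real.rpow_le_rpow (by positivity) (le_max_left _ _) (by linarith)
              _ ≤ Q ^ ‖s‖ := Real.rpow_le_rpow_of_exponent_le hQ1 hs1
          · refine hG.trans ?_
            gcongr
      _ = _ := by ring
  -- From y + 2 ≤ 3y, valid for y = 1 + |s| ≥ 1.
  set c : ℝ := 3 ^ (3 / 2 : ℝ) with hc
  have hc0 : 0 ≤ c := by positivity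
  refine ⟨Real.log T + I + (16 * A + Real.log Q + 2 * c) + 1, by positivity, fun s => ?_⟩
  set y := 1 + ‖s‖ with hy
  have hy1 : 1 ≤ y := by linarith [norm_nonneg s]
  set Y := y ^ (3 / 2 : ℝ) with hY
  have hyY : y ≤ Y := by
    simpa using Real.rpow_le_rpow_of_exponent_le hy1 (show (1 : ℝ) ≤ 3 / 2 by norm_num)
  have hY1 : 1 ≤ Y := hy1.trans hyY
  have hall : ‖completedRiemannZeta₀ s‖ ≤
      T ^ y * I + 16 * A * (Q ^ y * Real.exp (2 * (y + 2) ^ (3 / 2 : ℝ))) := by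
    -- The functional equation replaces s by 1 − s when Re s ≤ 1/2, at the cost |1 − s| ≤ 1 + |s|.
    obtain ⟨s', hs', hn, he⟩ : ∃ s' : ℂ, 1 / 2 ≤ s'.re ∧ ‖s'‖ ≤ y ∧
        completedRiemannZeta₀ s' = completedRiemannZeta₀ s := by
      rcases le_total (1 / 2) s.re with h | h
      · exact ⟨s, h, by linarith, rfl⟩
      · refine ⟨1 - s, ?_, ?_, completedRiemannZeta₀_one_sub s⟩
        · simp only [Complex.sub_re, Complex.one_re]
          linarith
        · simpa using norm_sub_le 1 s
    rw [← he]
    refine (hright s' hs').trans ?_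
    gcongr
  have e1 : T ^ y * I ≤ Real.exp ((Real.log T + I) * Y) := by
    rw [Real.rpow_def_of_pos (by linarith), add_mul, Real.exp_add]
    gcongr
    calc I ≤ Real.exp I := by linarith [Real.add_one_le_exp I]
      _ ≤ Real.exp (I * Y) := Real.exp_le_exp.mpr (le_mul_of_one_le_right hI hY1)
  have e2 : 16 * A * (Q ^ y * Real.exp (2 * (y + 2) ^ (3 / 2 : ℝ))) ≤
      Real.exp ((16 * A + Real.log Q + 2 * c) * Y) := by
    have h3 : (y + 2) ^ (3 / 2 : ℝ) ≤ c * Y := by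
      rw [hc, hY, ← Real.mul_rpow (by norm_num) (by linarith)]
      exact Real.rpow_le_rpow (by linarith) (by linarith) (by norm_num)
    rw [Real.rpow_def_of_pos (by linarith), show (16 * A + Real.log Q + 2 * c) * Y =
      16 * A * Y + (Real.log Q * Y + 2 * c * Y) by ring, Real.exp_add, Real.exp_add]
    have h4 : 16 * A ≤ Real.exp (16 * A * Y) :=
      calc 16 * A ≤ Real.exp (16 * A) := by linarith [Real.add_one_le_exp (16 * A)]
        _ ≤ Real.exp (16 * A * Y) :=
          Real.exp_le_exp.mpr (le_mul_of_one_le_right (by positivity) hY1)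
    have h5 : Real.exp (Real.log Q * y) ≤ Real.exp (Real.log Q * Y) := by gcongr
    have h6 : Real.exp (2 * (y + 2) ^ (3 / 2 : ℝ)) ≤ Real.exp (2 * c * Y) := by
      rw [Real.exp_le_exp]
      linarith
    exact mul_le_mul h4 (mul_le_mul h5 h6 (by positivity) (by positivity)) (by positivity)
      (by positivity)
  set a := (Real.log T + I) * Y with ha
  set b := (16 * A + Real.log Q + 2 * c) * Y with hb
  have ha0 : 0 ≤ a := by positivity
  have hb0 : 0 ≤ b := by positivity
  calc ‖completedRiemannZeta₀ s‖ ≤ Real.exp a + Real.exp b := hall.trans (add_le_add e1 e2)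
    _ ≤ Real.exp (a + b) + Real.exp (a + b) := by gcongr <;> linarith
    _ = 2 * Real.exp (a + b) := by ring
    _ ≤ Real.exp 1 * Real.exp (a + b) := by
        gcongr
        linarith [Real.add_one_le_exp 1]
    _ ≤ Real.exp ((Real.log T + I + (16 * A + Real.log Q + 2 * c) + 1) * Y) := by
        rw [← Real.exp_add, Real.exp_le_exp, ha, hb]
        nlinarith

/-! ### The function ξ -/

/-- The entire function `s (s - 1) Λ(s)`, which vanishes at the nontrivial zeros of `ζ`. -/
noncomputable def xi (s : ℂ) : ℂ := s * (s - 1) * completedRiemannZeta₀ s + 1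

theorem differentiable_xi : Differentiable ℂ xi := by
  have := differentiable_completedZeta₀
  unfold xi
  fun_prop

theorem xi_zero : xi 0 = 1 := by simp [xi]

theorem xi_one_sub (s : ℂ) : xi (1 - s) = xi s := by
  rw [xi, xi, completedRiemannZeta₀_one_sub]
  ring

theorem exists_norm_xi_le : ∃ C : ℝ, ∀ s : ℂ,
    ‖xi s‖ ≤ Real.exp (C * (1 + ‖s‖) ^ (3 / 2 : ℝ)) := by
  obtain ⟨C, hC, h⟩ := exists_norm_completedRiemannZeta₀_le
  refine ⟨C + 3, fun s => ?_⟩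
  have hn := norm_nonneg s
  set y := 1 + ‖s‖ with hy
  have hy1 : 1 ≤ y := by linarith
  set Y := y ^ (3 / 2 : ℝ) with hY
  have hyY : y ≤ Y := by
    simpa using Real.rpow_le_rpow_of_exponent_le hy1 (show (1 : ℝ) ≤ 3 / 2 by norm_num)
  have hY1 : 1 ≤ Y := hy1.trans hyY
  have e1 : y ≤ Real.exp Y := hyY.trans (by linarith [Real.add_one_le_exp Y])
  have h1 : ‖s - 1‖ ≤ y := by
    have := norm_sub_le s 1
    rw [norm_one] at this
    linarith
  have hE : 1 ≤ Real.exp (C * Y + 2 * Y) := Real.one_le_exp (by positivity)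
  calc ‖xi s‖ ≤ ‖s‖ * ‖s - 1‖ * ‖completedRiemannZeta₀ s‖ + 1 := by
        refine (norm_add_le _ _).trans ?_
        rw [norm_mul, norm_mul, norm_one]
    _ ≤ Real.exp Y * Real.exp Y * Real.exp (C * Y) + 1 := by
        gcongr
        · linarith
        · linarith
        · exact h s
    _ = Real.exp (C * Y + 2 * Y) + 1 := by
        rw [← Real.exp_add, ← Real.exp_add]
        ring_nf
    _ ≤ 2 * Real.exp (C * Y + 2 * Y) := by linarith
    _ ≤ Real.exp 1 * Real.exp (C * Y + 2 * Y) := by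
        gcongr
        linarith [Real.add_one_le_exp 1]
    _ ≤ Real.exp ((C + 3) * Y) := by
        rw [← Real.exp_add, Real.exp_le_exp]
        linarith

/-! ### Iterated derivatives and the digamma series -/

theorem iteratedDeriv_comp_mul_add {f : ℂ → ℂ} {c d x : ℂ} (hf : AnalyticAt ℂ f (c * x + d))
    (k : ℕ) :
    iteratedDeriv k (fun z => f (c * z + d)) x = c ^ k * iteratedDeriv k f (c * x + d) := by
  induction k generalizing f with
  | zero => simp
  | succ k ih =>
    have hev : deriv (fun z => f (c * z + d)) =ᶠ[𝓝 x] fun z => c * deriv f (c * z + d) := by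
      have hc : ContinuousAt (fun z : ℂ => c * z + d) x := by fun_prop
      filter_upwards [hc.eventually hf.eventually_analyticAt] with z hz
      have h1 : HasDerivAt (fun z : ℂ => c * z + d) c z := by
        simpa using ((hasDerivAt_id z).const_mul c).add_const d
      rw [mul_comm]
      exact (hz.differentiableAt.hasDerivAt.comp z h1).deriv
    rw [iteratedDeriv_succ', hev.iteratedDeriv_eq, iteratedDeriv_const_mul_field, ih hf.deriv,
      iteratedDeriv_succ', pow_succ]
    ring

theorem tendstoLocallyUniformlyOn_iteratedDeriv {F : ℕ → ℂ → ℂ} {g : ℂ → ℂ} {U : Set ℂ}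
    (hU : IsOpen U) (hF : ∀ n, DifferentiableOn ℂ (F n) U)
    (h : TendstoLocallyUniformlyOn F g atTop U) (k : ℕ) :
    TendstoLocallyUniformlyOn (fun n => iteratedDeriv k (F n)) (iteratedDeriv k g) atTop U := by
  induction k with
  | zero => simpa using h
  | succ k ih =>
    have := ih.deriv (Eventually.of_forall fun n => ?_) hU
    · simpa only [iteratedDeriv_succ, Function.comp_def] using this
    · have hA : AnalyticOnNhd ℂ (F n) U := (hF n).analyticOnNhd hU
      rw [iteratedDeriv_eq_iterate]
      exact (hA.iterated_deriv k).differentiableOn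

/-- The terms of the series for the digamma function. -/
noncomputable def digammaTerm (j : ℕ) (z : ℂ) : ℂ := 1 / ((j : ℂ) + 1) - 1 / (z + j)

/-- Over a common denominator the term is (z − 1)/((j + 1)(z + j)), and |z + j| ≥ Re(z + j) ≥ δ(j +
1) because δ ≤ 1. This is the majorant for the Weierstrass test. -/
theorem norm_digammaTerm_le {δ B : ℝ} (hδ : 0 < δ) (hδ1 : δ ≤ 1) {z : ℂ} (hz : δ < z.re)
    (hzB : ‖z‖ < B) (j : ℕ) : ‖digammaTerm j z‖ ≤ (B + 1) / δ * (1 / ((j : ℝ) + 1) ^ 2) := by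
  have hre : δ * (j + 1) ≤ (z + j).re := by
    simp only [Complex.add_re, Complex.natCast_re]
    nlinarith [(Nat.cast_nonneg j : (0 : ℝ) ≤ j)]
  have h1 : δ * (j + 1) ≤ ‖z + j‖ := hre.trans (Complex.re_le_norm _)
  have hpos : 0 < δ * ((j : ℝ) + 1) := by positivity
  have hne : z + j ≠ 0 := norm_pos_iff.mp (hpos.trans_le h1)
  have hj : (j : ℂ) + 1 ≠ 0 := by exact_mod_cast j.succ_ne_zero
  have e : digammaTerm j z = (z - 1) / (((j : ℂ) + 1) * (z + j)) := by
    rw [digammaTerm]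
    field_simp
    ring
  have hn : ‖(j : ℂ) + 1‖ = (j : ℝ) + 1 := by
    have := Complex.norm_natCast (j + 1)
    push_cast at this
    exact this
  rw [e, norm_div, norm_mul, hn]
  have h2 : ‖z - 1‖ ≤ B + 1 := by
    have := norm_sub_le z 1
    rw [norm_one] at this
    linarith
  calc ‖z - 1‖ / (((j : ℝ) + 1) * ‖z + j‖) ≤ (B + 1) / (((j : ℝ) + 1) * (δ * (j + 1))) := by
        gcongr
        exact (norm_nonneg _).trans h2
    _ = _ := by field_simp

theorem tendstoUniformlyOn_digammaTerm {δ B : ℝ} (hδ : 0 < δ) (hδ1 : δ ≤ 1) :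
    TendstoUniformlyOn (fun n z => ∑ j ∈ Finset.range n, digammaTerm j z)
      (fun z => ∑' j, digammaTerm j z) atTop {z : ℂ | δ < z.re ∧ ‖z‖ < B} := by
  refine tendstoUniformlyOn_tsum_nat (u := fun j : ℕ => (B + 1) / δ * (1 / ((j : ℝ) + 1) ^ 2)) ?_
    fun j z hz => norm_digammaTerm_le hδ hδ1 hz.1 hz.2 j
  refine Summable.mul_left _ ?_
  have := (summable_nat_add_iff 1).mpr (Real.summable_one_div_nat_pow.mpr one_lt_two)
  simpa using this

theorem differentiableOn_digammaTerm (j : ℕ) {δ B : ℝ} (hδ : 0 < δ) :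
    DifferentiableOn ℂ (digammaTerm j) {z : ℂ | δ < z.re ∧ ‖z‖ < B} := by
  intro z hz
  have : z + j ≠ 0 := by
    intro h
    have h1 := congrArg Complex.re h
    simp only [Complex.add_re, Complex.natCast_re, Complex.zero_re] at h1
    linarith [hz.1, (Nat.cast_nonneg j : (0 : ℝ) ≤ j)]
  unfold digammaTerm
  refine DifferentiableAt.differentiableWithinAt ?_
  fun_prop (disch := assumption)

theorem isOpen_re_norm (δ B : ℝ) : IsOpen {z : ℂ | δ < z.re ∧ ‖z‖ < B} :=
  (isOpen_lt continuous_const Complex.continuous_re).inter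
    (isOpen_lt continuous_norm continuous_const)

/-- Termwise differentiation of the Euler limit for log Γ, justified by locally uniform convergence
of the derivatives. Each derivative splits into log n − H_{n+1}, which tends to −γ, and a partial
sum of the digamma series. -/
theorem hasDerivAt_log_Gamma {x : ℝ} (hx : 0 < x) :
    HasDerivAt (fun y => Real.log (Real.Gamma y))
      (-Real.eulerMascheroniConstant + (∑' j, digammaTerm j x).re) x := by
  set δ := min (x / 2) 1 with hδ
  have hδ0 : 0 < δ := lt_min (by positivity) one_pos
  have hδ1 : δ ≤ 1 := min_le_right _ _
  have hδx : δ < x := (min_le_left _ _).trans_lt (by linarith)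
  set B := x + 1 with hB
  have hu := tendstoUniformlyOn_digammaTerm (B := B) hδ0 hδ1
  have hmaps : ∀ y ∈ Set.Ioo δ B, (y : ℂ) ∈ {z : ℂ | δ < z.re ∧ ‖z‖ < B} := by
    intro y hy
    refine ⟨by simpa using hy.1, ?_⟩
    rw [Complex.norm_real, Real.norm_of_nonneg (hδ0.trans hy.1).le]
    exact hy.2
  have hu2 : TendstoUniformlyOn
      (fun n (y : ℝ) => (∑ j ∈ Finset.range (n + 1), digammaTerm j y).re)
      (fun y : ℝ => (∑' j, digammaTerm j (y : ℂ)).re) atTop (Set.Ioo δ B) := by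
    rw [Metric.tendstoUniformlyOn_iff] at hu ⊢
    intro ε hε
    filter_upwards [(tendsto_add_atTop_nat 1).eventually (hu ε hε)] with n hn y hy
    refine lt_of_le_of_lt ?_ (hn y (hmaps y hy))
    rw [Real.dist_eq, Complex.dist_eq, ← Complex.sub_re]
    exact Complex.abs_re_le_norm _
  -- `logGammaSeq` sums over 0 ≤ j ≤ n, hence H_{n+1} instead of H_n; the difference 1/(n + 1)
  -- vanishes in the limit.
  have hconst : Tendsto (fun n : ℕ => Real.log n - (harmonic (n + 1) : ℝ)) atTop
      (𝓝 (-Real.eulerMascheroniConstant)) := by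
    have h1 := Real.tendsto_harmonic_sub_log
    have h2 := h1.add tendsto_one_div_add_atTop_nhds_zero_nat
    rw [add_zero] at h2
    refine h2.neg.congr fun n => ?_
    rw [harmonic_succ]
    push_cast
    rw [one_div]
    ring
  have hconst' : TendstoUniformlyOn (fun (n : ℕ) (_ : ℝ) => Real.log n - (harmonic (n + 1) : ℝ))
      (fun _ => -Real.eulerMascheroniConstant) atTop (Set.Ioo δ B) := by
    rw [Metric.tendstoUniformlyOn_iff]
    intro ε hε
    filter_upwards [Metric.tendsto_nhds.mp hconst ε hε] with n hn y _
    rwa [dist_comm]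
  refine hasDerivAt_of_tendstoLocallyUniformlyOn isOpen_Ioo
    (hconst'.add hu2).tendstoLocallyUniformlyOn
    (f := fun n y => Real.BohrMollerup.logGammaSeq y n)
    (Eventually.of_forall fun n y hy => ?_)
    (fun y hy => Real.BohrMollerup.tendsto_log_gamma (hδ0.trans hy.1)) ⟨hδx, by linarith⟩
  have hy0 : 0 < y := hδ0.trans hy.1
  have hd : HasDerivAt (fun y => Real.BohrMollerup.logGammaSeq y n)
      (Real.log n - ∑ j ∈ Finset.range (n + 1), 1 / (y + j)) y := by
    unfold Real.BohrMollerup.logGammaSeq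
    refine HasDerivAt.sub ?_ (HasDerivAt.fun_sum fun j _ => ?_)
    · simpa using ((hasDerivAt_id y).mul_const (Real.log n)).add_const (Real.log n.factorial)
    · exact ((hasDerivAt_id y).add_const (j : ℝ)).log (by positivity)
  have hterm : ∀ j : ℕ, (digammaTerm j y).re = ((j : ℝ) + 1)⁻¹ - 1 / (y + j) := by
    intro j
    have : digammaTerm j y = ((((j : ℝ) + 1)⁻¹ - 1 / (y + j) : ℝ) : ℂ) := by
      rw [digammaTerm]
      push_cast
      rw [one_div]
    rw [this, Complex.ofReal_re]
  have e : Real.log n - ∑ j ∈ Finset.range (n + 1), 1 / (y + j) =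
      Real.log n - (harmonic (n + 1) : ℝ) +
        (∑ j ∈ Finset.range (n + 1), digammaTerm j y).re := by
    simp only [Complex.re_sum, hterm, Finset.sum_sub_distrib, harmonic]
    push_cast
    ring
  rw [e] at hd
  exact hd

theorem digamma_ofReal {x : ℝ} (hx : 0 < x) :
    Complex.digamma x = -Real.eulerMascheroniConstant + ∑' j, digammaTerm j x := by
  have hG : Real.Gamma x ≠ 0 := (Real.Gamma_pos_of_pos hx).ne'
  have h1 : HasDerivAt (fun y : ℝ => Complex.Gamma y) (deriv Complex.Gamma x) x :=
    (Complex.differentiableAt_Gamma _ fun m h => by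
      have h2 := congrArg Complex.re h
      simp only [Complex.ofReal_re, Complex.neg_re, Complex.natCast_re] at h2
      linarith [(Nat.cast_nonneg m : (0 : ℝ) ≤ m)]).hasDerivAt.comp_ofReal
  have hd : HasDerivAt Real.Gamma (deriv Real.Gamma x) x :=
    (Real.differentiableAt_Gamma fun m h => by
      linarith [(Nat.cast_nonneg m : (0 : ℝ) ≤ m)]).hasDerivAt
  have h2 := hd.ofReal_comp
  have h3 := h1.unique (h2.congr_of_eventuallyEq
    (Eventually.of_forall fun y => Complex.Gamma_ofReal y))
  have h4 := (hd.log hG).unique (hasDerivAt_log_Gamma hx)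
  have him : ((∑' j, digammaTerm j x).re : ℂ) = ∑' j, digammaTerm j x := by
    have : ∀ j : ℕ, digammaTerm j x = ((1 / ((j : ℝ) + 1) - 1 / (x + j) : ℝ) : ℂ) := by
      intro j
      rw [digammaTerm]
      push_cast
      rfl
    simp only [this]
    rw [← Complex.ofReal_tsum, Complex.ofReal_re]
  rw [Complex.digamma_def, logDeriv_apply, h3, Complex.Gamma_ofReal, ← Complex.ofReal_div, h4,
    Complex.ofReal_add, him, Complex.ofReal_neg]

theorem analyticAt_digamma {z : ℂ} (hz : 0 < z.re) : AnalyticAt ℂ Complex.digamma z := by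
  have hU : IsOpen {w : ℂ | 0 < w.re} := isOpen_lt continuous_const Complex.continuous_re
  have hd : DifferentiableOn ℂ Complex.Gamma {w : ℂ | 0 < w.re} := by
    intro w hw
    refine (Complex.differentiableAt_Gamma _ fun m h => ?_).differentiableWithinAt
    have h2 := congrArg Complex.re h
    have hw' : 0 < w.re := hw
    simp only [Complex.neg_re, Complex.natCast_re] at h2
    linarith [(Nat.cast_nonneg m : (0 : ℝ) ≤ m)]
  exact analyticAt_logDeriv (hd.analyticAt (hU.mem_nhds hz)) (Complex.Gamma_ne_zero_of_re_pos hz)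

theorem tendsto_sum_iteratedDeriv_digamma {x : ℝ} (hx : 0 < x) {k : ℕ} (hk : 0 < k) :
    Tendsto (fun n => ∑ j ∈ Finset.range n, (1 / ((x : ℂ) + j)) ^ (k + 1)) atTop
      (𝓝 ((-1) ^ (k + 1) * (iteratedDeriv k Complex.digamma x / k.factorial))) := by
  set δ := min (x / 2) 1 with hδ
  have hδ0 : 0 < δ := lt_min (by positivity) one_pos
  have hδ1 : δ ≤ 1 := min_le_right _ _
  have hδx : δ < x := (min_le_left _ _).trans_lt (by linarith)
  set B := x + 1 with hB
  set U := {z : ℂ | δ < z.re ∧ ‖z‖ < B} with hUdef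
  have hU : IsOpen U := isOpen_re_norm δ B
  have hxU : (x : ℂ) ∈ U := by
    refine ⟨by simpa using hδx, ?_⟩
    rw [Complex.norm_real, Real.norm_of_nonneg hx.le]
    linarith
  have hF : ∀ n, DifferentiableOn ℂ (fun z => ∑ j ∈ Finset.range n, digammaTerm j z) U := fun n =>
    DifferentiableOn.fun_sum fun j _ => differentiableOn_digammaTerm j hδ0
  have hlu := (tendstoUniformlyOn_digammaTerm (B := B) hδ0 hδ1).tendstoLocallyUniformlyOn
  have hD : AnalyticAt ℂ (fun z => ∑' j, digammaTerm j z) x :=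
    (hlu.differentiableOn (Eventually.of_forall hF) hU).analyticAt (hU.mem_nhds hxU)
  -- Both sides are analytic at x and agree at positive reals, which accumulate at x; the identity
  -- theorem applies.
  have heq : Complex.digamma =ᶠ[𝓝 (x : ℂ)]
      fun z => -(Real.eulerMascheroniConstant : ℂ) + ∑' j, digammaTerm j z := by
    have hA : AnalyticAt ℂ
        (fun z => -(Real.eulerMascheroniConstant : ℂ) + ∑' j, digammaTerm j z) x :=
      analyticAt_const.add hD
    refine ((analyticAt_digamma (by simpa using hx)).frequently_eq_iff_eventually_eq hA).mp ?_
    have ht : Tendsto (fun y : ℝ => (y : ℂ)) (𝓝[≠] x) (𝓝[≠] (x : ℂ)) := by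
      refine tendsto_nhdsWithin_iff.mpr
        ⟨Complex.continuous_ofReal.continuousAt.tendsto.mono_left nhdsWithin_le_nhds, ?_⟩
      filter_upwards [self_mem_nhdsWithin] with y hy
      simpa using hy
    refine ht.frequently (Eventually.frequently ?_)
    filter_upwards [(eventually_gt_nhds hx).filter_mono nhdsWithin_le_nhds] with y hy
    exact digamma_ofReal hy
  have hlim := (tendstoLocallyUniformlyOn_iteratedDeriv hU hF hlu k).tendsto_at hxU
  have hiter : iteratedDeriv k Complex.digamma x =
      iteratedDeriv k (fun z => ∑' j, digammaTerm j z) x := by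
    rw [heq.iteratedDeriv_eq, iteratedDeriv_const_add hk]
  have hterm : ∀ j : ℕ, iteratedDeriv k (digammaTerm j) x =
      (-1) ^ (k + 1) * (k.factorial * (1 / ((x : ℂ) + j)) ^ (k + 1)) := by
    intro j
    have e : digammaTerm j = fun z : ℂ => 1 / ((j : ℂ) + 1) - (1 * z + (j : ℂ))⁻¹ := by
      funext z
      rw [digammaTerm, one_mul, one_div (z + j)]
    rw [e, iteratedDeriv_const_sub hk, iteratedDeriv_neg, iteratedDeriv_eq_iterate,
      iter_deriv_inv_linear]
    have h1 : (1 * (x : ℂ) + j) ^ (-1 - (k : ℤ)) = (1 / ((x : ℂ) + j)) ^ (k + 1) := by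
      rw [show (-1 - (k : ℤ)) = -((k + 1 : ℕ) : ℤ) by push_cast; ring, zpow_neg, zpow_natCast]
      simp
    simp only [h1]
    ring
  have hk0 : (k.factorial : ℂ) ≠ 0 := by exact_mod_cast k.factorial_ne_zero
  rw [hiter]
  refine ((hlim.div_const (k.factorial : ℂ)).const_mul ((-1) ^ (k + 1))).congr fun n => ?_
  rw [iteratedDeriv_fun_sum (fun j _ =>
    ((differentiableOn_digammaTerm j hδ0).analyticAt (hU.mem_nhds hxU)).contDiffAt)]
  simp only [hterm]
  rw [← Finset.mul_sum, ← Finset.mul_sum, mul_div_assoc, mul_div_cancel_left₀ _ hk0, ← mul_assoc,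
    ← mul_pow]
  simp

/-! ### Zeros of ξ and of ζ -/

/-- The gamma factor `2 π ^ (-s / 2) Γ(s / 2 + 1)`. -/
noncomputable def gammaFactor (s : ℂ) : ℂ :=
  2 * (Real.pi : ℂ) ^ (-s / 2) * Complex.Gamma (1 / 2 * s + 1)

theorem half_mul_add_one_ne_neg_natCast {s : ℂ} (hs : ¬∃ n : ℕ, s = -2 * ((n : ℂ) + 1)) (m : ℕ) :
    1 / 2 * s + 1 ≠ -m := fun h => hs ⟨m, by linear_combination 2 * h⟩

theorem gammaFactor_ne_zero {s : ℂ} (hs : ¬∃ n : ℕ, s = -2 * ((n : ℂ) + 1)) :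
    gammaFactor s ≠ 0 := by
  have hpi : (Real.pi : ℂ) ≠ 0 := by exact_mod_cast Real.pi_ne_zero
  refine mul_ne_zero (mul_ne_zero two_ne_zero ?_)
    (Complex.Gamma_ne_zero (half_mul_add_one_ne_neg_natCast hs))
  rw [Complex.cpow_ne_zero_iff]
  exact Or.inl hpi

/-- The factor s is absorbed by sΓ(s/2) = 2Γ(s/2 + 1), so the factorisation also holds at s = 0,
where the first formula is read off. -/
theorem xi_eq {s : ℂ} (hs : ¬∃ n : ℕ, s = -2 * ((n : ℂ) + 1)) (h1 : s ≠ 1) :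
    xi s = (s - 1) * gammaFactor s * riemannZeta s := by
  have hG := gammaFactor_ne_zero hs
  have h2 : 1 - s ≠ 0 := sub_ne_zero.mpr h1.symm
  have e : 2 * (Real.pi : ℂ) ^ (-s / 2) * Complex.Gamma (s / 2 + 1) = gammaFactor s := by
    rw [gammaFactor, one_div, inv_mul_eq_div]
  rw [riemannZeta_eq_mul_completedRiemannZeta₀, e, xi]
  field_simp
  ring

theorem not_exists_eq_neg_two_mul {s : ℂ} (hs : -2 < s.re) :
    ¬∃ n : ℕ, s = -2 * ((n : ℂ) + 1) := by
  rintro ⟨n, rfl⟩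
  simp only [Complex.mul_re, Complex.neg_re, Complex.re_ofNat, Complex.add_re, Complex.natCast_re,
    Complex.one_re, Complex.neg_im, Complex.im_ofNat, neg_zero, zero_mul, sub_zero] at hs
  linarith [(Nat.cast_nonneg n : (0 : ℝ) ≤ n)]

theorem differentiableAt_gammaFactor {s : ℂ} (hs : ¬∃ n : ℕ, s = -2 * ((n : ℂ) + 1)) :
    DifferentiableAt ℂ gammaFactor s := by
  have hpi : (Real.pi : ℂ) ≠ 0 := by exact_mod_cast Real.pi_ne_zero
  have h1 : DifferentiableAt ℂ (fun s : ℂ => Complex.Gamma (1 / 2 * s + 1)) s :=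
    (Complex.differentiableAt_Gamma _ (half_mul_add_one_ne_neg_natCast hs)).comp s (by fun_prop)
  have h2 : DifferentiableAt ℂ (fun s : ℂ => (Real.pi : ℂ) ^ (-s / 2)) s :=
    DifferentiableAt.const_cpow (by fun_prop) (Or.inl hpi)
  exact (h2.const_mul 2).mul h1

/-- The points have mutual distance at least 2. Closedness supplies the neighbourhoods on which
`xi_eq` holds. -/
theorem isClosed_trivialZeros : IsClosed {s : ℂ | ∃ n : ℕ, s = -2 * ((n : ℂ) + 1)} := by
  have h : Topology.IsClosedEmbedding fun n : ℕ => -2 * ((n : ℂ) + 1) := by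
    refine Metric.isClosedEmbedding_of_pairwise_le_dist (ε := 2) (by norm_num) fun m n hmn => ?_
    have h1 : (1 : ℝ) ≤ |(m : ℝ) - n| := by
      have : (1 : ℤ) ≤ |(m : ℤ) - n| := Int.one_le_abs (sub_ne_zero.mpr (by exact_mod_cast hmn))
      exact_mod_cast this
    change 2 ≤ dist (-2 * ((m : ℂ) + 1)) (-2 * ((n : ℂ) + 1))
    rw [dist_eq_norm, show -2 * ((m : ℂ) + 1) - -2 * ((n : ℂ) + 1) = (((-2) * ((m : ℝ) - n) : ℝ) : ℂ)
      by push_cast; ring, Complex.norm_real, norm_mul, Real.norm_eq_abs ((m : ℝ) - n)]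
    norm_num
    linarith
  convert h.isClosed_range using 1
  ext s
  simp [eq_comm]

theorem analyticAt_gammaFactor {s : ℂ} (hs : ¬∃ n : ℕ, s = -2 * ((n : ℂ) + 1)) :
    AnalyticAt ℂ gammaFactor s :=
  DifferentiableOn.analyticAt (s := {s : ℂ | ∃ n : ℕ, s = -2 * ((n : ℂ) + 1)}ᶜ)
    (fun _ hw => (differentiableAt_gammaFactor hw).differentiableWithinAt)
    (isClosed_trivialZeros.isOpen_compl.mem_nhds hs)

theorem analyticOrderNatAt_xi_of_mem {ρ : ℂ} (hρ : ρ ∈ nontrivialZeros) :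
    analyticOrderNatAt xi ρ = zeroMult ρ := by
  obtain ⟨-, htriv, h1⟩ := hρ
  have hev : xi =ᶠ[𝓝 ρ] (fun s => (s - 1) * gammaFactor s) * riemannZeta := by
    filter_upwards [isClosed_trivialZeros.isOpen_compl.mem_nhds htriv,
      isOpen_ne.mem_nhds h1] with s hs hs1
    exact xi_eq hs hs1
  have hz : AnalyticAt ℂ riemannZeta ρ := analyticOn_riemannZeta ρ h1
  have hg : AnalyticAt ℂ (fun s => (s - 1) * gammaFactor s) ρ :=
    (analyticAt_id.sub analyticAt_const).mul (analyticAt_gammaFactor htriv)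
  have h0 : analyticOrderAt (fun s => (s - 1) * gammaFactor s) ρ = 0 :=
    hg.analyticOrderAt_eq_zero.mpr (mul_ne_zero (sub_ne_zero.mpr h1) (gammaFactor_ne_zero htriv))
  rw [zeroMult, analyticOrderNatAt, analyticOrderNatAt, analyticOrderAt_congr hev,
    analyticOrderAt_mul hg hz, h0, zero_add]

theorem xi_ne_zero_of_notMem {ρ : ℂ} (hρ : ρ ∉ nontrivialZeros) : xi ρ ≠ 0 := by
  by_cases h1 : ρ = 1
  · simp [h1, xi]
  by_cases htriv : ∃ n : ℕ, ρ = -2 * ((n : ℂ) + 1)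
  -- `xi_eq` is unavailable at a trivial zero; reflection moves the point to 1 − ρ = 2n + 3, where ζ
  -- does not vanish.
  · obtain ⟨n, rfl⟩ := htriv
    have hre : 1 < (1 - -2 * ((n : ℂ) + 1)).re := by
      simp only [Complex.sub_re, Complex.mul_re, Complex.neg_re, Complex.re_ofNat, Complex.add_re,
        Complex.natCast_re, Complex.one_re, Complex.neg_im, Complex.im_ofNat, neg_zero, zero_mul,
        sub_zero]
      linarith [(Nat.cast_nonneg n : (0 : ℝ) ≤ n)]
    have hne : 1 - -2 * ((n : ℂ) + 1) ≠ 1 := fun h => by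
      rw [h, Complex.one_re] at hre
      exact lt_irrefl _ hre
    have ht := not_exists_eq_neg_two_mul (s := 1 - -2 * ((n : ℂ) + 1)) (by linarith)
    rw [← xi_one_sub, xi_eq ht hne]
    exact mul_ne_zero (mul_ne_zero (sub_ne_zero.mpr hne) (gammaFactor_ne_zero ht))
      (riemannZeta_ne_zero_of_one_le_re hre.le)
  · have hz : riemannZeta ρ ≠ 0 := fun hz => hρ ⟨hz, htriv, h1⟩
    rw [xi_eq htriv h1]
    exact mul_ne_zero (mul_ne_zero (sub_ne_zero.mpr h1) (gammaFactor_ne_zero htriv)) hz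

theorem hasSum_nontrivialZeros {k : ℕ} (hk : 0 < k) :
    HasSum (fun ρ : nontrivialZeros => (zeroMult (ρ : ℂ) : ℂ) * (-1 / (ρ : ℂ)) ^ (k + 1))
      ((-1) ^ k * (iteratedDeriv k (logDeriv xi) 0 / k.factorial)) := by
  obtain ⟨C, hC⟩ := exists_norm_xi_le
  -- The hypothesis k ≥ 1 puts k + 1 above the growth exponent 3/2.
  have hk' : (3 / 2 : ℝ) < k + 1 := by
    have : (1 : ℝ) ≤ k := by exact_mod_cast hk
    linarith
  have h := hasSum_order_mul_inv_pow differentiable_xi xi_zero (by norm_num) hC hk'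
  have h2 := h.mul_left ((-1) ^ (k + 1))
  have e : (-1 : ℂ) ^ (k + 1) * -(iteratedDeriv k (logDeriv xi) 0 / k.factorial) =
      (-1) ^ k * (iteratedDeriv k (logDeriv xi) 0 / k.factorial) := by ring
  rw [e, ← hasSum_subtype_iff_of_support_subset (s := nontrivialZeros)] at h2
  · refine h2.congr_fun fun ρ => ?_
    rw [Function.comp_apply, analyticOrderNatAt_xi_of_mem ρ.2, neg_div, neg_pow (1 / (ρ : ℂ))]
    ring
  · intro ρ hρ
    by_contra hn
    refine hρ ?_
    have : analyticOrderNatAt xi ρ = 0 := by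
      by_contra h
      exact xi_ne_zero_of_notMem hn (apply_eq_zero_of_analyticOrderNatAt_ne_zero h)
    simp [this]

/-! ### The coefficients of −ζ'/ζ at 0 and at 1 -/

theorem logDeriv_gammaFactor {s : ℂ} (hs : ¬∃ n : ℕ, s = -2 * ((n : ℂ) + 1)) :
    logDeriv gammaFactor s =
      -(Complex.log Real.pi / 2) + 1 / 2 * Complex.digamma (1 / 2 * s + 1) := by
  have hpi : (Real.pi : ℂ) ≠ 0 := by exact_mod_cast Real.pi_ne_zero
  have hp : (Real.pi : ℂ) ^ (-s / 2) ≠ 0 := by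
    rw [Complex.cpow_ne_zero_iff]
    exact Or.inl hpi
  have hG := Complex.Gamma_ne_zero (half_mul_add_one_ne_neg_natCast hs)
  have h1 : HasDerivAt (fun s : ℂ => Complex.Gamma (1 / 2 * s + 1))
      (deriv Complex.Gamma (1 / 2 * s + 1) * (1 / 2)) s := by
    have hl : HasDerivAt (fun s : ℂ => 1 / 2 * s + 1) (1 / 2) s := by
      simpa using ((hasDerivAt_id s).const_mul (1 / 2 : ℂ)).add_const 1
    exact (Complex.differentiableAt_Gamma _
      (half_mul_add_one_ne_neg_natCast hs)).hasDerivAt.comp s hl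
  have h2 : HasDerivAt (fun s : ℂ => (Real.pi : ℂ) ^ (-s / 2))
      ((Real.pi : ℂ) ^ (-s / 2) * Complex.log Real.pi * (-1 / 2)) s :=
    HasDerivAt.const_cpow ((hasDerivAt_id s).fun_neg.div_const 2) (Or.inl hpi)
  have h3 : HasDerivAt gammaFactor _ s := (h2.const_mul 2).mul h1
  rw [logDeriv_apply, h3.deriv, gammaFactor, Complex.digamma_def, logDeriv_apply]
  generalize Complex.Gamma (1 / 2 * s + 1) = G at hG ⊢
  generalize (Real.pi : ℂ) ^ (-s / 2) = p at hp ⊢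
  field_simp

/-- Logarithmic derivative of `xi_eq`, solved for −ζ'/ζ. The bracket is analytic at both 0 and 1, so
1/(s − 1) carries the whole pole. -/
theorem negLogDerivZeta_eq {s : ℂ} (hs : ¬∃ n : ℕ, s = -2 * ((n : ℂ) + 1)) (h1 : s ≠ 1)
    (hz : riemannZeta s ≠ 0) : negLogDerivZeta s = 1 / (s - 1) +
      (-logDeriv xi s + (-(Complex.log Real.pi / 2)
        + 1 / 2 * Complex.digamma (1 / 2 * s + 1))) := by
  have hev : xi =ᶠ[𝓝 s] fun s => (s - 1) * gammaFactor s * riemannZeta s := by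
    filter_upwards [isClosed_trivialZeros.isOpen_compl.mem_nhds hs,
      isOpen_ne.mem_nhds h1] with w hw hw1
    exact xi_eq hw hw1
  have h10 : s - 1 ≠ 0 := sub_ne_zero.mpr h1
  have hG := gammaFactor_ne_zero hs
  have hl : logDeriv xi s = logDeriv (fun s => (s - 1) * gammaFactor s * riemannZeta s) s := by
    rw [logDeriv_apply, logDeriv_apply, hev.deriv_eq, hev.eq_of_nhds]
  have hd : DifferentiableAt ℂ (fun s : ℂ => s - 1) s := by fun_prop
  have hlin : logDeriv (fun s : ℂ => s - 1) s = 1 / (s - 1) := by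
    rw [logDeriv_apply, ((hasDerivAt_id' s).sub_const 1).deriv]
  rw [hl, logDeriv_mul (f := fun s => (s - 1) * gammaFactor s) s (mul_ne_zero h10 hG) hz
    (hd.fun_mul (differentiableAt_gammaFactor hs)) (differentiableAt_riemannZeta h1),
    logDeriv_mul (f := fun s => s - 1) s h10 hG hd (differentiableAt_gammaFactor hs),
    logDeriv_gammaFactor hs, hlin, negLogDerivZeta, logDeriv_apply riemannZeta]
  ring

theorem logDeriv_xi_one_sub (s : ℂ) : logDeriv xi (1 - s) = -logDeriv xi s := by
  have h1 : HasDerivAt (fun s => xi (1 - s)) (deriv xi (1 - s) * -1) s :=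
    (differentiable_xi (1 - s)).hasDerivAt.comp s ((hasDerivAt_id' s).const_sub 1)
  have h2 := (differentiable_xi s).hasDerivAt
  rw [show (fun s => xi (1 - s)) = xi from funext xi_one_sub] at h1
  rw [logDeriv_apply, logDeriv_apply, xi_one_sub, ← h1.unique h2]
  ring

theorem analyticAt_logDeriv_xi_zero : AnalyticAt ℂ (logDeriv xi) 0 :=
  analyticAt_logDeriv (differentiable_xi.analyticAt 0) (by simp [xi_zero])

theorem analyticAt_digamma_half_mul_add_one {s : ℂ} (hs : -2 < s.re) :
    AnalyticAt ℂ (fun s : ℂ => Complex.digamma (1 / 2 * s + 1)) s := by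
  refine AnalyticAt.fun_comp (g := Complex.digamma) (analyticAt_digamma ?_) (by fun_prop)
  have : (1 / 2 * s + 1).re = s.re / 2 + 1 := by simp; ring
  rw [this]
  linarith

/-- The Taylor coefficients of the gamma part of `-ζ' / ζ`. -/
theorem iteratedDeriv_digamma_half_mul_add_one {s : ℂ} (hs : -2 < s.re) {k : ℕ} (hk : 0 < k) :
    iteratedDeriv k (fun s => -(Complex.log Real.pi / 2)
      + 1 / 2 * Complex.digamma (1 / 2 * s + 1)) s =
      (1 / 2) ^ (k + 1) * iteratedDeriv k Complex.digamma (1 / 2 * s + 1) := by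
  have : (1 / 2 * s + 1).re = s.re / 2 + 1 := by simp; ring
  rw [iteratedDeriv_const_add hk, iteratedDeriv_const_mul_field,
    iteratedDeriv_comp_mul_add (analyticAt_digamma (by rw [this]; linarith))]
  ring

/-- The summand −1 is the Taylor coefficient of 1/(s − 1) at 0, and the digamma argument s/2 + 1
equals 1 there. -/
theorem muCoeff_eq {k : ℕ} (hk : 0 < k) : muCoeff k =
    (-1) ^ k * (-1 - iteratedDeriv k (logDeriv xi) 0 / k.factorial +
      (1 / 2) ^ (k + 1) * (iteratedDeriv k Complex.digamma 1 / k.factorial)) := by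
  have hz : ∀ᶠ s in 𝓝 (0 : ℂ), riemannZeta s ≠ 0 :=
    (differentiableAt_riemannZeta zero_ne_one).continuousAt.eventually_ne (by
      rw [riemannZeta_zero]
      norm_num)
  have ht : ¬∃ n : ℕ, (0 : ℂ) = -2 * ((n : ℂ) + 1) := not_exists_eq_neg_two_mul (by simp)
  have hev : negLogDerivZeta =ᶠ[𝓝 0] fun s => (1 * s - 1)⁻¹ +
      (-logDeriv xi s + (-(Complex.log Real.pi / 2)
        + 1 / 2 * Complex.digamma (1 / 2 * s + 1))) := by
    filter_upwards [hz, isClosed_trivialZeros.isOpen_compl.mem_nhds ht,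
      isOpen_ne.mem_nhds (zero_ne_one (α := ℂ))] with s hs hs2 hs1
    rw [negLogDerivZeta_eq hs2 hs1 hs, one_div, one_mul]
  have hA1 : AnalyticAt ℂ (fun s : ℂ => (1 * s - 1)⁻¹) 0 := by
    refine AnalyticAt.inv (by fun_prop) (by simp)
  have hA3 : AnalyticAt ℂ (fun s : ℂ => -(Complex.log Real.pi / 2)
      + 1 / 2 * Complex.digamma (1 / 2 * s + 1)) 0 :=
    analyticAt_const.add (analyticAt_const.mul (analyticAt_digamma_half_mul_add_one (by simp)))
  have hA2 := analyticAt_logDeriv_xi_zero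
  have hk0 : (k.factorial : ℂ) ≠ 0 := by exact_mod_cast k.factorial_ne_zero
  have h1 : iteratedDeriv k (fun s : ℂ => (1 * s - 1)⁻¹) 0 = -k.factorial := by
    rw [iteratedDeriv_eq_iterate, iter_deriv_inv_linear_sub]
    have h2 : (1 * (0 : ℂ) - 1) ^ (-1 - (k : ℤ)) = (-1) ^ (k + 1) := by
      rw [show (-1 - (k : ℤ)) = -((k + 1 : ℕ) : ℤ) by push_cast; ring, zpow_neg, zpow_natCast]
      simp [← inv_pow]
    simp only [h2, one_pow, mul_one]
    rw [mul_right_comm, pow_succ, ← mul_assoc, ← mul_pow]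
    simp
  rw [muCoeff, hev.iteratedDeriv_eq, iteratedDeriv_fun_add hA1.contDiffAt
    (hA2.fun_neg.fun_add hA3).contDiffAt, iteratedDeriv_fun_add hA2.fun_neg.contDiffAt
    hA3.contDiffAt, iteratedDeriv_fun_neg, h1,
    iteratedDeriv_digamma_half_mul_add_one (by simp) hk, mul_zero, zero_add]
  field_simp
  ring

/-- The pole cancels, and −ξ'/ξ(s) = ξ'/ξ(1 − s) moves the expansion point from 1 to 0; the sign
(−1)^k is the chain rule for s ↦ 1 − s. -/
theorem etaCoeff_eq {k : ℕ} (hk : 0 < k) : etaCoeff k =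
    (-1) ^ k * (iteratedDeriv k (logDeriv xi) 0 / k.factorial) +
      (1 / 2) ^ (k + 1) * (iteratedDeriv k Complex.digamma ((3 / 2 : ℝ) : ℂ) / k.factorial) := by
  have ht : ¬∃ n : ℕ, (1 : ℂ) = -2 * ((n : ℂ) + 1) :=
    not_exists_eq_neg_two_mul (by rw [Complex.one_re]; norm_num)
  have e0 : (-1 : ℂ) * 1 + 1 = 0 := by norm_num
  have hA2 : AnalyticAt ℂ (fun s : ℂ => logDeriv xi (-1 * s + 1)) 1 := by
    refine AnalyticAt.fun_comp (g := logDeriv xi) ?_ (by fun_prop)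
    rw [e0]
    exact analyticAt_logDeriv_xi_zero
  have hA3 : AnalyticAt ℂ (fun s : ℂ => -(Complex.log Real.pi / 2)
      + 1 / 2 * Complex.digamma (1 / 2 * s + 1)) 1 :=
    analyticAt_const.add (analyticAt_const.mul
      (analyticAt_digamma_half_mul_add_one (by rw [Complex.one_re]; norm_num)))
  have hev : regularPart =ᶠ[𝓝 1] fun s => logDeriv xi (-1 * s + 1) +
      (-(Complex.log Real.pi / 2) + 1 / 2 * Complex.digamma (1 / 2 * s + 1)) := by
    -- Agreement off s = 1 suffices for two functions analytic at 1, so the filled-in value need not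
    -- be computed.
    refine (analyticAt_regularPart.frequently_eq_iff_eventually_eq (hA2.fun_add hA3)).mp
      (Eventually.frequently ?_)
    filter_upwards [self_mem_nhdsWithin,
      riemannZeta_eventually_ne_zero_nhds_one.filter_mono nhdsWithin_le_nhds,
      (isClosed_trivialZeros.isOpen_compl.mem_nhds ht : _ ∈ 𝓝 (1 : ℂ)) |> mem_nhdsWithin_of_mem_nhds]
      with s hs hz hst
    have hs1 : s ≠ 1 := hs
    rw [regularPart, Function.update_of_ne hs1, negLogDerivZeta_eq hst hs1 hz,
      show -1 * s + 1 = 1 - s by ring, logDeriv_xi_one_sub]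
    ring
  rw [etaCoeff, hev.iteratedDeriv_eq, iteratedDeriv_fun_add hA2.contDiffAt hA3.contDiffAt,
    iteratedDeriv_comp_mul_add (by rw [e0]; exact analyticAt_logDeriv_xi_zero), e0,
    iteratedDeriv_digamma_half_mul_add_one (by rw [Complex.one_re]; norm_num) hk,
    show (1 / 2 : ℂ) * 1 + 1 = ((3 / 2 : ℝ) : ℂ) by push_cast; norm_num]
  ring

/-! ### The digamma sums as zeta values -/

theorem hasSum_one_div_nat_add_one_pow {k : ℕ} (hk : 0 < k) :
    HasSum (fun j : ℕ => (1 / ((j : ℂ) + 1)) ^ (k + 1)) (riemannZeta ((k : ℂ) + 1)) := by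
  have hs : Summable fun j : ℕ => (1 / (j : ℂ)) ^ (k + 1) := by
    refine Summable.of_norm ?_
    have := Real.summable_one_div_nat_pow.mpr (show 1 < k + 1 by omega)
    simpa using this
  have hz := zeta_nat_eq_tsum_of_gt_one (show 1 < k + 1 by omega)
  have h := hs.hasSum
  have e : ∑' j : ℕ, (1 / (j : ℂ)) ^ (k + 1) = riemannZeta ((k : ℂ) + 1) := by
    push_cast at hz
    rw [hz]
    simp
  -- The dropped term j = 0 is a power of 1/0 = 0.
  rw [e, ← hasSum_nat_add_iff' 1] at h
  simpa using h

/-- Since 3/2 + j = (2j + 3)/2, this is 2^(k+1) times the sum over the odd integers from 3 on: ζ(k +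
1) without its even part and without the term 1. -/
theorem hasSum_one_div_three_halves_add_nat_pow {k : ℕ} (hk : 0 < k) :
    HasSum (fun j : ℕ => (1 / (((3 / 2 : ℝ) : ℂ) + j)) ^ (k + 1))
      (2 ^ (k + 1) * ((1 - 1 / 2 ^ (k + 1)) * riemannZeta ((k : ℂ) + 1) - 1)) := by
  have hz := hasSum_one_div_nat_add_one_pow hk
  -- The index is shifted by one: odd indices 2j + 1 stand for the even integers 2j + 2.
  have hodd : HasSum (fun j : ℕ => (1 / (((2 * j + 1 : ℕ) : ℂ) + 1)) ^ (k + 1))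
      (1 / 2 ^ (k + 1) * riemannZeta ((k : ℂ) + 1)) := by
    refine (hz.mul_left (1 / 2 ^ (k + 1))).congr_fun fun j => ?_
    rw [← one_div_pow, ← mul_pow]
    have : (j : ℂ) + 1 ≠ 0 := by exact_mod_cast j.succ_ne_zero
    push_cast
    rw [show 2 * (j : ℂ) + 1 + 1 = 2 * (j + 1) by ring]
    field_simp
  have heven : Summable fun j : ℕ => (1 / (((2 * j : ℕ) : ℂ) + 1)) ^ (k + 1) :=
    hz.summable.comp_injective (i := fun j : ℕ => 2 * j) fun a b h => by simpa using h
  have hsum := (heven.hasSum.even_add_odd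
    (f := fun j : ℕ => (1 / ((j : ℂ) + 1)) ^ (k + 1)) hodd).unique hz
  have h := heven.hasSum
  rw [eq_sub_of_add_eq hsum, ← hasSum_nat_add_iff' 1] at h
  have h2 := h.mul_left (2 ^ (k + 1))
  have e : (2 : ℂ) ^ (k + 1) * (riemannZeta ((k : ℂ) + 1)
      - 1 / 2 ^ (k + 1) * riemannZeta ((k : ℂ) + 1)
      - ∑ i ∈ Finset.range 1, (1 / (((2 * i : ℕ) : ℂ) + 1)) ^ (k + 1)) =
      2 ^ (k + 1) * ((1 - 1 / 2 ^ (k + 1)) * riemannZeta ((k : ℂ) + 1) - 1) := by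
    simp
    ring
  rw [e] at h2
  refine h2.congr_fun fun j => ?_
  rw [← mul_pow]
  congr 1
  have : ((2 * (j + 1) : ℕ) : ℂ) + 1 = 2 * (((3 / 2 : ℝ) : ℂ) + j) := by push_cast; ring
  rw [this]
  field_simp

end ZetaPowerSums

/-! ### The two formulas -/

theorem mainTheorem3 (k : ℕ) (hk : 0 < k) :
    HasSum
      (fun ρ : ZetaPowerSums.nontrivialZeros =>
        (ZetaPowerSums.zeroMult (ρ : ℂ) : ℂ) * (-1 / (ρ : ℂ)) ^ (k + 1))
      (-ZetaPowerSums.muCoeff k - (1 / 2 ^ (k + 1)) * riemannZeta ((k : ℂ) + 1) - (-1) ^ k) ∧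
    HasSum
      (fun ρ : ZetaPowerSums.nontrivialZeros =>
        (ZetaPowerSums.zeroMult (ρ : ℂ) : ℂ) * (-1 / (ρ : ℂ)) ^ (k + 1))
      (ZetaPowerSums.etaCoeff k + (-1) ^ k * (1 - 1 / 2 ^ (k + 1)) * riemannZeta ((k : ℂ) + 1)
        - (-1) ^ k) := by
  have hmain := ZetaPowerSums.hasSum_nontrivialZeros hk
  have hsq : ((-1 : ℂ) ^ k) * (-1) ^ k = 1 := by
    rw [← mul_pow]
    simp
  have h2 : (1 / 2 : ℂ) ^ (k + 1) * 2 ^ (k + 1) = 1 := by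
    rw [← mul_pow]
    simp
  constructor
  -- At x = 1 the digamma sum is ζ(k + 1), so ψ^{(k)}(1)/k! = (−1)^(k+1) ζ(k + 1).
  · have h1 := tendsto_nhds_unique
      (ZetaPowerSums.tendsto_sum_iteratedDeriv_digamma one_pos hk)
      (((ZetaPowerSums.hasSum_one_div_nat_add_one_pow hk).congr_fun fun j => by
        rw [Complex.ofReal_one, add_comm]).tendsto_sum_nat)
    rw [Complex.ofReal_one] at h1
    convert hmain using 1
    rw [ZetaPowerSums.muCoeff_eq hk, ← h1, ← one_div_pow, pow_succ (-1 : ℂ)]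
    ring
  · have h1 := tendsto_nhds_unique
      (ZetaPowerSums.tendsto_sum_iteratedDeriv_digamma (x := 3 / 2) (by norm_num) hk)
      (ZetaPowerSums.hasSum_one_div_three_halves_add_nat_pow hk).tendsto_sum_nat
    have h3 : iteratedDeriv k Complex.digamma ((3 / 2 : ℝ) : ℂ) / k.factorial = -(-1) ^ k *
        (2 ^ (k + 1) * ((1 - 1 / 2 ^ (k + 1)) * riemannZeta ((k : ℂ) + 1) - 1)) := by
      rw [← h1, pow_succ]
      linear_combination (-(iteratedDeriv k Complex.digamma ((3 / 2 : ℝ) : ℂ) / k.factorial)) * hsq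
    convert hmain using 1
    rw [ZetaPowerSums.etaCoeff_eq hk, h3]
    linear_combination (-(-1) ^ k *
      ((1 - 1 / 2 ^ (k + 1)) * riemannZeta ((k : ℂ) + 1) - 1)) * h2
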